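/- **Convergence rates of filtered back projection for noisy data.** *Notation.* For $1\le p\le\infty$ and $f:\mathbb R^2\to\mathbb R$ put $\omega_p(f,t)=\sup_{\|h\|\le t}\|f(\cdot-h)-f\|_{L^p(\mathbb R^2)}$. For $0<\theta<1$ let $|f|_{B^{\theta,p}_q}=\big(\int_0^\infty (t^{-\theta}\omega_p(f,t))^q\,\frac{dt}{t}\big)^{1/q}$ if $1\le q<\infty$ and $|f|_{B^{\theta,p}_\infty}=\sup_{t>0}t^{-\theta}\omega_p(f,t)$. For $\alpha=n+\theta$ with an integer $n\ge 0$ let $|f|_{B^{\alpha,p}_q}=\sum_{j_1+j_2=n}\frac{n!}{j_1!j_2!}|f^{(j_1,j_2)}|_{B^{\theta,p}_q}$, with weak derivatives $f^{(j_1,j_2)}$ (and $|f|_{B^{\alpha,p}_q}=\infty$ if one of them does not exist), and $B^{\alpha,p}_q=\{f\in L^p(\mathbb R^2): |f|_{B^{\alpha,p}_q}<\infty\}$. The Radon transform $\mathcal Rf(t,\varphi)$, $(t,\varphi)\in\mathbb R\times[0,\pi)$, is the integral of $f$ over the line $\{x\cos\varphi+y\sin\varphi=t\}$; the back projection is $\mathcal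 Bh(x,y)=\frac1\pi\int_0^\pi h(x\cos\varphi+y\sin\varphi,\varphi)\,d\varphi$; and $\mathcal F^{-1}A(t)=\frac1{2\pi}\int_{\mathbb R}A(S)e^{iSt}\,dS$. For a window $W:\mathbb R\to\mathbb R$ and $L>0$ put $A_L(S)=|S|\,W(S/L)$, $A=A_1$, and $K=\frac12\mathcal B(\mathcal F^{-1}A)$. The reconstruction from data $g$ is $\frac12\mathcal B(\mathcal F^{-1}A_L*g)$, with convolution in the first variable of $g$. *Statement.* Let $1\le p,q\le\infty$, $\alpha=n+\theta$ with an integer $n\ge0$ and $0<\theta<1$, and let $f\in L^1(\mathbb R^2)\cap B^{\alpha,p}_q(\mathbb R^2)$ be real-valued, vanish almost everywhere outside a compact set $\Omega\subset\mathbb R^2$, and satisfy $|f|_{B^{\alpha,p}_q}\neq0$. Let $W\in L^\infty(\mathbb R)$ be even and continuous at $0$ with $W(0)=1$, such that $A\in L^1(\mathbb R)\cap L^2(\mathbb R)$, $\mathcal F^{-1}A\in L^1(\mathbb R)$, $K\in L^1(\mathbb R^2)$, $$\int_{\mathbb R^2}x^{j_1}y^{j_2}K(x,y)\,d(x,y)=0\quad\text{for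 all } 1\le j_1+j_2\le n,\qquad \int_{\mathbb R^2}\|(x,y)\|^\alpha|K(x,y)|\,d(x,y)<\infty .$$ Let $\delta>0$, let $g^\delta\in L^p(\mathbb R\times[0,\pi))$ satisfy $\|\mathcal Rf-g^\delta\|_{L^p(\mathbb R\times[0,\pi))}\le\delta$, and let $f_L^\delta=\frac12\mathcal B(\mathcal F^{-1}A_L*g^\delta)$ with the bandwidth $$L=\delta^{-\frac1{\alpha+1}}\,|f|_{B^{\alpha,p}_q}^{\frac1{\alpha+1}} .$$ Then $f-f_L^\delta\in L^p(\Omega)$ and $$\|f-f_L^\delta\|_{L^p(\Omega)}\le (c_{W,\alpha,q}+c_{W,\Omega,p})\,|f|_{B^{\alpha,p}_q}^{\frac1{\alpha+1}}\,\delta^{\frac{\alpha}{\alpha+1}},$$ where, with $1/\infty=0$, $$c_{W,\Omega,p}=\frac{\operatorname{diam}(\Omega)^{1/p}}{2\pi^{1/p}}\,\|\mathcal F^{-1}A\|_{L^1(\mathbb R)},\qquad c_{W,\alpha,q}=c_{\theta,q}\,\frac{\Gamma(\theta+1)}{\Gamma(\alpha+1)}\int_{\mathbb R^2}\|(x,y)\|^\alpha|K(x,y)|\,d(x,y),$$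 and $c_{\theta,q}=(2e\theta q)^{1/q}$ for $q<\infty$, $c_{\theta,\infty}=1$. In particular, given such data $g^\delta$ for every $\delta>0$, $\|f-f_L^\delta\|_{L^p(\Omega)}=O\big(\delta^{\frac{\alpha}{\alpha+1}}\big)$ as $\delta\searrow0$. -/

import Mathlib

open MeasureTheory Filter Topology Asymptotics
open scoped ENNReal

namespace FBP

noncomputable section

/-- The plane `ℝ²` with its Euclidean norm and Lebesgue measure. -/
abbrev Plane : Type := EuclideanSpace ℝ (Fin 2)

/-! ### Besov seminorms -/

/-- The `Lᵖ`-modulus of continuity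
`ω_p(f, t) = sup_{‖h‖ ≤ t} ‖f(· - h) - f‖_{Lᵖ(ℝ²)}`, with values in `[0, ∞]`. -/
def modulus (p : ℝ≥0∞) (f : Plane → ℝ) (t : ℝ) : ℝ≥0∞ :=
  ⨆ (h : Plane) (_ : ‖h‖ ≤ t), eLpNorm (fun x => f (x - h) - f x) p volume

/-- The Besov seminorm of fractional order `θ ∈ (0, 1)`:
`(∫₀^∞ (t^(-θ) ω_p(f, t))^q dt/t)^(1/q)` for `q < ∞`, and
`sup_{t > 0} t^(-θ) ω_p(f, t)` for `q = ∞`. -/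
def fracSeminorm (θ : ℝ) (p q : ℝ≥0∞) (f : Plane → ℝ) : ℝ≥0∞ :=
  if q = ⊤ then
    ⨆ (t : ℝ) (_ : 0 < t), ENNReal.ofReal (t ^ (-θ)) * modulus p f t
  else
    (∫⁻ t in Set.Ioi (0 : ℝ),
      (ENNReal.ofReal (t ^ (-θ)) * modulus p f t) ^ q.toReal * ENNReal.ofReal (1 / t))
      ^ (1 / q.toReal)

/-- The classical partial derivative in the `i`-th coordinate direction. -/
def partialD (i : Fin 2) (φ : Plane → ℝ) : Plane → ℝ :=
  fun x => fderiv ℝ φ x (EuclideanSpace.single i 1)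

/-- The classical partial derivative of multi-index `j = (j₁, j₂)`. -/
def multiD (j : ℕ × ℕ) (φ : Plane → ℝ) : Plane → ℝ :=
  (partialD 0)^[j.1] ((partialD 1)^[j.2] φ)

/-- `g` is the weak (distributional) derivative of `f` of multi-index `j`. -/
def HasWeakDeriv (j : ℕ × ℕ) (f g : Plane → ℝ) : Prop :=
  LocallyIntegrable g volume ∧
    ∀ φ : Plane → ℝ, ContDiff ℝ (⊤ : ℕ∞) φ → HasCompactSupport φ →
      ∫ x, f x * multiD j φ x = (-1) ^ (j.1 + j.2) * ∫ x, g x * φ x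

open Classical in
/-- A representative of the weak derivative `f^(j)`, which is unique up to null sets
(and `0` if there is none). -/
def weakDeriv (j : ℕ × ℕ) (f : Plane → ℝ) : Plane → ℝ :=
  if h : ∃ g, HasWeakDeriv j f g then h.choose else 0

open Classical in
/-- The seminorm of `B^{n+θ,p}_q(ℝ²)`,
`∑_{j₁ + j₂ = n} n!/(j₁! j₂!) |f^(j₁,j₂)|_{B^{θ,p}_q}`,
being `∞` if one of the weak derivatives of order `n` does not exist.
For `n = 0` this is `|f|_{B^{θ,p}_q}`. -/
def besovSeminorm (n : ℕ) (θ : ℝ) (p q : ℝ≥0∞) (f : Plane → ℝ) : ℝ≥0∞ :=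
  if ∀ j ∈ Finset.HasAntidiagonal.antidiagonal n, ∃ g, HasWeakDeriv j f g then
    ∑ j ∈ Finset.HasAntidiagonal.antidiagonal n, (n.choose j.1 : ℝ≥0∞) * fracSeminorm θ p q (weakDeriv j f)
  else ⊤

/-- Membership in `B^{n+θ,p}_q(ℝ²)`. -/
def MemBesov (n : ℕ) (θ : ℝ) (p q : ℝ≥0∞) (f : Plane → ℝ) : Prop :=
  MemLp f p volume ∧ besovSeminorm n θ p q f < ⊤

/-! ### Radon transform, back projection, filters -/

/-- Radon transform: the integral of `f` over the line
`{(x, y) | x cos φ + y sin φ = t}`, parametrized by arc length; the argument is `(t, φ)`. -/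
def radon (f : Plane → ℝ) (z : ℝ × ℝ) : ℝ :=
  ∫ s : ℝ, f !₂[z.1 * Real.cos z.2 - s * Real.sin z.2, z.1 * Real.sin z.2 + s * Real.cos z.2]

/-- Lebesgue measure on `ℝ × [0, π)`. -/
def sinoMeasure : Measure (ℝ × ℝ) :=
  volume.restrict (Set.univ ×ˢ Set.Ico 0 Real.pi)

/-- Back projection `(1/π) ∫₀^π h(x cos φ + y sin φ, φ) dφ`. -/
def backProj (h : ℝ × ℝ → ℂ) (x : Plane) : ℂ :=
  (1 / Real.pi : ℝ) • ∫ φ in (0 : ℝ)..Real.pi, h (x 0 * Real.cos φ + x 1 * Real.sin φ, φ)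

/-- The low-pass filter `A_L(S) = |S| W(S/L)`. -/
def lowPass (W : ℝ → ℝ) (L : ℝ) (S : ℝ) : ℝ := |S| * W (S / L)

/-- The inverse Fourier transform `(1/2π) ∫ A(S) e^{iSt} dS`. -/
def invFourier (A : ℝ → ℝ) (t : ℝ) : ℂ :=
  (1 / (2 * Real.pi) : ℝ) • ∫ S : ℝ, (A S : ℂ) * Complex.exp (Complex.I * S * t)

/-- The convolution kernel `K_L = (1/2) B(F⁻¹ A_L)` on the plane. -/
def convKernel (W : ℝ → ℝ) (L : ℝ) (x : Plane) : ℂ :=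
  (1 / 2 : ℝ) • backProj (fun z => invFourier (lowPass W L) z.1) x

/-- The filtered data `F⁻¹ A_L * g`, a convolution in the first variable. -/
def filtered (W : ℝ → ℝ) (L : ℝ) (g : ℝ × ℝ → ℝ) (z : ℝ × ℝ) : ℂ :=
  ∫ s : ℝ, invFourier (lowPass W L) s * (g (z.1 - s, z.2) : ℂ)

/-- The filtered back projection reconstruction `(1/2) B(F⁻¹ A_L * g)` from the data `g`. -/
def reconstruction (W : ℝ → ℝ) (L : ℝ) (g : ℝ × ℝ → ℝ) (x : Plane) : ℂ :=
  (1 / 2 : ℝ) • backProj (filtered W L g) x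

/-! ### Constants and the choice of the bandwidth -/

/-- `c_{θ,q} = (2 e θ q)^(1/q)` for `q < ∞`, and `1` for `q = ∞`. -/
def cFrac (θ : ℝ) (q : ℝ≥0∞) : ℝ :=
  if q = ⊤ then 1 else (2 * Real.exp 1 * θ * q.toReal) ^ (1 / q.toReal)

/-- `c_{W,α,q}` for `α = n + θ`. -/
def cApprox (W : ℝ → ℝ) (n : ℕ) (θ : ℝ) (q : ℝ≥0∞) : ℝ :=
  cFrac θ q * (Real.Gamma (θ + 1) / Real.Gamma (n + θ + 1)) *
    ∫ x : Plane, ‖x‖ ^ (n + θ) * ‖convKernel W 1 x‖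

/-- `c_{W,Ω,p} = (1/2) π^(-1/p) diam(Ω)^(1/p) ‖F⁻¹ A‖_{L¹(ℝ)}`. For `p = ∞`, the exponent
`1 / p.toReal` is `0`, in accordance with `1/∞ = 0`. -/
def cData (W : ℝ → ℝ) (Ω : Set Plane) (p : ℝ≥0∞) : ℝ :=
  1 / (2 * Real.pi ^ (1 / p.toReal)) * Metric.diam Ω ^ (1 / p.toReal) *
    ∫ t : ℝ, ‖invFourier (lowPass W 1) t‖

/-- The bandwidth `L = δ^(-1/(α+1)) N^(1/(α+1))`, where `N` is the Besov seminorm. -/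
def bandwidth (α N δ : ℝ) : ℝ := δ ^ (-(1 / (α + 1))) * N ^ (1 / (α + 1))

end

end FBP

/-!
Applied to exact data, filtered back projection is the convolution `f * K_L`, because the integral
of a function of `x cos φ + y sin φ` against `f` is an integral against the Radon transform. The
kernels `K_L = L² K(L ·)` have mass `W 0 = 1` by Fourier inversion at the origin (in polar
coordinates the Jacobian is the ramp `|S|` of the filter) and vanishing moments up to order `n`.
Hence `f - f * K_L` averages the Taylor remainders of order `n` of `f` against `K_L`. The integral
form of the remainder, Minkowski's inequality and `ω_p(g, t) ≤ c_{θ,q} t^θ |g|_{B^{θ,p}_q}` bound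
it by `c_{W,α,q} L^(-α) |f|`; the quotient of Gamma functions is the Beta integral left over by
the remainder. Weak derivatives are handled by mollification, which does not increase the seminorm.

The data error is amplified by at most `c_{W,Ω,p} L`: by Young's inequality the filter contributes
its `L¹` norm, which is proportional to `L`, and by Hölder's inequality in the angle together with
the fact that lines meet `Ω` in sets of length at most `diam Ω`, the back projection is bounded
from `Lᵖ(ℝ × [0, π))` to `Lᵖ(Ω)`. The bandwidth balances the two contributions.
-/

namespace FBP

section Minkowski

variable {X Y : Type*} [MeasurableSpace X] [MeasurableSpace Y] {μ : Measure X} {ν : Measure Y}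
  {p : ℝ≥0∞}

theorem lintegral_rpow_le_measure_univ_rpow_mul {r : ℝ} (hr : 1 ≤ r) {h : Y → ℝ≥0∞}
    (hh : AEMeasurable h ν) :
    (∫⁻ y, h y ∂ν) ^ r ≤ ν Set.univ ^ (r - 1) * ∫⁻ y, h y ^ r ∂ν := by
  have hr0 : 0 < r := zero_lt_one.trans_le hr
  have hp0 : ENNReal.ofReal r ≠ 0 := by simpa using hr0
  have holder := eLpNorm_le_eLpNorm_mul_rpow_measure_univ (p := 1)
    (ENNReal.one_le_ofReal.2 hr) hh.aestronglyMeasurable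
  rw [eLpNorm_one_eq_lintegral_enorm,
    eLpNorm_eq_lintegral_rpow_enorm_toReal hp0 ENNReal.ofReal_ne_top] at holder
  simp only [enorm_eq_self, ENNReal.toReal_ofReal hr0.le, ENNReal.toReal_one] at holder
  calc (∫⁻ y, h y ∂ν) ^ r
      ≤ ((∫⁻ y, h y ^ r ∂ν) ^ (1 / r) * ν Set.univ ^ (1 / 1 - 1 / r)) ^ r := by gcongr
    _ = ν Set.univ ^ (r - 1) * ∫⁻ y, h y ^ r ∂ν := by
      rw [ENNReal.mul_rpow_of_nonneg _ _ hr0.le, ← ENNReal.rpow_mul, ← ENNReal.rpow_mul,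
        one_div_mul_cancel hr0.ne', ENNReal.rpow_one, mul_comm]
      congr 2
      field_simp

theorem lintegral_lintegral_rpow_le_of_forall_le [SFinite μ] [SFinite ν] {r : ℝ} (hr : 1 ≤ r)
    {F : X → Y → ℝ≥0∞} (hF : Measurable (Function.uncurry F)) {c : ℝ≥0∞}
    (h : ∀ᵐ y ∂ν, ∫⁻ x, F x y ^ r ∂μ ≤ c ^ r) :
    ∫⁻ x, (∫⁻ y, F x y ∂ν) ^ r ∂μ ≤ (c * ν Set.univ) ^ r := by
  have hFr : Measurable fun z : X × Y => F z.1 z.2 ^ r := hF.pow_const r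
  calc ∫⁻ x, (∫⁻ y, F x y ∂ν) ^ r ∂μ
      ≤ ∫⁻ x, ν Set.univ ^ (r - 1) * ∫⁻ y, F x y ^ r ∂ν ∂μ :=
        lintegral_mono fun x => lintegral_rpow_le_measure_univ_rpow_mul hr
          (hF.of_uncurry_left (x := x)).aemeasurable
    _ = ν Set.univ ^ (r - 1) * ∫⁻ y, ∫⁻ x, F x y ^ r ∂μ ∂ν := by
        rw [lintegral_const_mul _ hFr.lintegral_prod_right', lintegral_lintegral_swap
          hFr.aemeasurable]
    _ ≤ ν Set.univ ^ (r - 1) * (c ^ r * ν Set.univ) := by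
        gcongr
        exact (lintegral_mono_ae h).trans (lintegral_const _).le
    _ = (c * ν Set.univ) ^ r := by
        rw [ENNReal.mul_rpow_of_nonneg _ _ (zero_le_one.trans hr), mul_left_comm]
        nth_rewrite 2 [← ENNReal.rpow_one (ν Set.univ)]
        rw [← ENNReal.rpow_add_of_nonneg _ _ (sub_nonneg.2 hr) zero_le_one, sub_add_cancel]

theorem eLpNorm_lintegral_le_mul_measure_univ [SFinite μ] [SFinite ν] (hp : 1 ≤ p)
    {F : X → Y → ℝ≥0∞} (hF : Measurable (Function.uncurry F)) {c : ℝ≥0∞}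
    (h : ∀ᵐ y ∂ν, eLpNorm (fun x => F x y) p μ ≤ c) :
    eLpNorm (fun x => ∫⁻ y, F x y ∂ν) p μ ≤ c * ν Set.univ := by
  rcases eq_or_ne p ∞ with rfl | hp_top
  · have hyx : ∀ᵐ y ∂ν, ∀ᵐ x ∂μ, F x y ≤ c := by
      filter_upwards [h] with y hy
      filter_upwards [ae_le_eLpNormEssSup (f := fun x => F x y) (μ := μ)] with x hx
      exact hx.trans hy
    have hxy : ∀ᵐ x ∂μ, ∀ᵐ y ∂ν, F x y ≤ c :=
      (Measure.ae_ae_comm (p := fun x y => F x y ≤ c)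
        (measurableSet_le hF measurable_const)).2 hyx
    refine eLpNormEssSup_le_of_ae_enorm_bound ?_
    filter_upwards [hxy] with x hx
    exact (lintegral_mono_ae hx).trans (lintegral_const c).le
  · have hp0 : p ≠ 0 := (zero_lt_one.trans_le hp).ne'
    have hr : 1 ≤ p.toReal := by simpa using ENNReal.toReal_mono hp_top hp
    have hr0 : 0 < p.toReal := zero_lt_one.trans_le hr
    simp only [eLpNorm_eq_lintegral_rpow_enorm_toReal hp0 hp_top, enorm_eq_self, one_div,
      ENNReal.rpow_inv_le_iff hr0] at h ⊢
    exact lintegral_lintegral_rpow_le_of_forall_le hr hF h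

theorem ae_ae_eq_zero_of_eLpNorm_le [SFinite μ] [SFinite ν] (hp : p ≠ 0) {F : X → Y → ℝ≥0∞}
    (hF : Measurable (Function.uncurry F)) {b : Y → ℝ≥0∞} (hb : Measurable b)
    (h : ∀ᵐ y ∂ν, eLpNorm (fun x => F x y) p μ ≤ b y) :
    ∀ᵐ x ∂μ, ∀ᵐ y ∂ν, b y = 0 → F x y = 0 := by
  refine (Measure.ae_ae_comm (p := fun x y => b y = 0 → F x y = 0) ?_).2 ?_
  · exact ((hb.comp measurable_snd) (measurableSet_singleton 0)).himp
      (hF (measurableSet_singleton 0))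
  · filter_upwards [h] with y hy
    by_cases hby : b y = 0
    · have hFy : Measurable fun x => F x y := hF.of_uncurry_right
      rw [hby, nonpos_iff_eq_zero, eLpNorm_eq_zero_iff hFy.aestronglyMeasurable hp] at hy
      filter_upwards [hy] with x hx _ using hx
    · exact ae_of_all _ fun x hx => absurd hx hby

-- Dividing `F · y` by `b y` and passing to the measure `b ν` reduces to the constant bound `1`.
theorem eLpNorm_lintegral_le_of_measurable [SFinite μ] [SFinite ν] (hp : 1 ≤ p)
    {F : X → Y → ℝ≥0∞} (hF : Measurable (Function.uncurry F)) {b : Y → ℝ≥0∞} (hb : Measurable b)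
    (h : ∀ᵐ y ∂ν, eLpNorm (fun x => F x y) p μ ≤ b y) :
    eLpNorm (fun x => ∫⁻ y, F x y ∂ν) p μ ≤ ∫⁻ y, b y ∂ν := by
  by_cases hb_top : ∫⁻ y, b y ∂ν = ∞
  · exact hb_top ▸ le_top
  have hb_fin : ∀ᵐ y ∂ν, b y < ∞ := ae_lt_top hb hb_top
  have hG : Measurable fun z : X × Y => (b z.2)⁻¹ * F z.1 z.2 :=
    (hb.comp measurable_snd).inv.mul hF
  have hG_le : ∀ᵐ y ∂ν.withDensity b, eLpNorm (fun x => (b y)⁻¹ * F x y) p μ ≤ 1 := by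
    rw [ae_withDensity_iff hb]
    filter_upwards [h] with y hy hy0
    lift (b y)⁻¹ to NNReal using ENNReal.inv_ne_top.2 hy0 with c hc
    calc eLpNorm (fun x => c * F x y) p μ
        ≤ c * eLpNorm (fun x => F x y) p μ :=
          eLpNorm_le_mul_eLpNorm_of_ae_le_mul' (ae_of_all _ fun x => le_rfl) p
      _ ≤ (b y)⁻¹ * b y := by rw [hc]; gcongr
      _ ≤ 1 := ENNReal.inv_mul_le_one (b y)
  have hF_eq : (fun x => ∫⁻ y, F x y ∂ν) =ᵐ[μ]
      fun x => ∫⁻ y, (b y)⁻¹ * F x y ∂ν.withDensity b := by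
    filter_upwards [ae_ae_eq_zero_of_eLpNorm_le (zero_lt_one.trans_le hp).ne' hF hb h] with x hx
    rw [lintegral_withDensity_eq_lintegral_mul (g := fun y => (b y)⁻¹ * F x y) _ hb
      (hG.comp measurable_prodMk_left)]
    refine lintegral_congr_ae ?_
    filter_upwards [hx, hb_fin] with y hy0 hy
    by_cases hby : b y = 0
    · simp [hby, hy0 hby]
    · simp [← mul_assoc, ENNReal.mul_inv_cancel hby hy.ne]
  calc eLpNorm (fun x => ∫⁻ y, F x y ∂ν) p μ
      = eLpNorm (fun x => ∫⁻ y, (b y)⁻¹ * F x y ∂ν.withDensity b) p μ := eLpNorm_congr_ae hF_eq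
    _ ≤ 1 * (ν.withDensity b) Set.univ := eLpNorm_lintegral_le_mul_measure_univ hp hG hG_le
    _ = ∫⁻ y, b y ∂ν := by simp

theorem eLpNorm_lintegral_le [SFinite μ] [SFinite ν] (hp : 1 ≤ p)
    {F : X → Y → ℝ≥0∞} (hF : AEMeasurable (Function.uncurry F) (μ.prod ν))
    {b : Y → ℝ≥0∞} (hb : AEMeasurable b ν)
    (h : ∀ᵐ y ∂ν, eLpNorm (fun x => F x y) p μ ≤ b y) :
    eLpNorm (fun x => ∫⁻ y, F x y ∂ν) p μ ≤ ∫⁻ y, b y ∂ν := by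
  have hF_x : ∀ᵐ x ∂μ, ∀ᵐ y ∂ν, F x y = hF.mk _ (x, y) := Measure.ae_ae_of_ae_prod hF.ae_eq_mk
  have hF_y : ∀ᵐ y ∂ν, ∀ᵐ x ∂μ, F x y = hF.mk _ (x, y) :=
    Measure.ae_ae_of_ae_prod (p := fun z : Y × X => F z.2 z.1 = hF.mk _ (z.2, z.1))
      (Measure.measurePreserving_swap.quasiMeasurePreserving.ae hF.ae_eq_mk)
  rw [lintegral_congr_ae hb.ae_eq_mk]
  refine (eLpNorm_congr_ae ?_).trans_le (eLpNorm_lintegral_le_of_measurable hp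
    (F := fun x y => hF.mk _ (x, y)) hF.measurable_mk hb.measurable_mk ?_)
  · filter_upwards [hF_x] with x hx using lintegral_congr_ae hx
  · filter_upwards [hF_y, hb.ae_eq_mk, h] with y hFy hby hy
    rw [← hby]
    exact (eLpNorm_congr_ae hFy).symm.trans_le hy

theorem eLpNorm_integral_le [SFinite μ] [SFinite ν] {E : Type*} [NormedAddCommGroup E]
    [NormedSpace ℝ E] (hp : 1 ≤ p)
    {F : X → Y → E} (hF : AEStronglyMeasurable (Function.uncurry F) (μ.prod ν))
    {b : Y → ℝ≥0∞} (hb : AEMeasurable b ν)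
    (h : ∀ᵐ y ∂ν, eLpNorm (fun x => F x y) p μ ≤ b y) :
    eLpNorm (fun x => ∫ y, F x y ∂ν) p μ ≤ ∫⁻ y, b y ∂ν :=
  calc eLpNorm (fun x => ∫ y, F x y ∂ν) p μ
      ≤ eLpNorm (fun x => ∫⁻ y, ‖F x y‖ₑ ∂ν) p μ :=
        eLpNorm_mono_enorm fun x => enorm_integral_le_lintegral_enorm _
    _ ≤ ∫⁻ y, b y ∂ν := eLpNorm_lintegral_le hp hF.enorm hb (by simpa using h)

end Minkowski

section Modulus

theorem lintegral_Ioi_rpow {a t : ℝ} (ha : a < -1) (ht : 0 < t) :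
    ∫⁻ s in Set.Ioi t, ENNReal.ofReal (s ^ a) = ENNReal.ofReal (-t ^ (a + 1) / (a + 1)) := by
  rw [← integral_Ioi_rpow_of_lt ha ht,
    ofReal_integral_eq_lintegral_ofReal (integrableOn_Ioi_rpow_of_lt ha ht)]
  filter_upwards [ae_restrict_mem measurableSet_Ioi] with s hs
  exact Real.rpow_nonneg (ht.trans hs).le _

-- Only the range `s > t`, where `ω s ≥ ω t`, contributes to the lower bound.
theorem rpow_mul_le_lintegral_of_monotone {ω : ℝ → ℝ≥0∞} (hω : Monotone ω) {θ r t : ℝ}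
    (hθ : 0 < θ) (hr : 0 < r) (ht : 0 < t) :
    ω t ^ r * ENNReal.ofReal (t ^ (-(θ * r)) / (θ * r)) ≤
      ∫⁻ s in Set.Ioi (0 : ℝ),
        (ENNReal.ofReal (s ^ (-θ)) * ω s) ^ r * ENNReal.ofReal (1 / s) := by
  have hθr : 0 < θ * r := mul_pos hθ hr
  have tail : ENNReal.ofReal (t ^ (-(θ * r)) / (θ * r)) =
      ∫⁻ s in Set.Ioi t, ENNReal.ofReal (s ^ (-(θ * r) - 1)) := by
    rw [lintegral_Ioi_rpow (by linarith) ht, sub_add_cancel, neg_div_neg_eq]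
  have weight {s : ℝ} (hs : 0 < s) : ENNReal.ofReal (s ^ (-(θ * r) - 1)) =
      ENNReal.ofReal (s ^ (-θ)) ^ r * ENNReal.ofReal (1 / s) := by
    rw [ENNReal.ofReal_rpow_of_nonneg (by positivity) hr.le, ← ENNReal.ofReal_mul (by positivity),
      ← Real.rpow_mul hs.le, Real.rpow_sub hs, Real.rpow_one, neg_mul, mul_one_div]
  calc ω t ^ r * ENNReal.ofReal (t ^ (-(θ * r)) / (θ * r))
      = ∫⁻ s in Set.Ioi t, ω t ^ r * ENNReal.ofReal (s ^ (-(θ * r) - 1)) := by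
        rw [tail, lintegral_const_mul _ (by fun_prop)]
    _ ≤ ∫⁻ s in Set.Ioi t, (ENNReal.ofReal (s ^ (-θ)) * ω s) ^ r * ENNReal.ofReal (1 / s) := by
        refine setLIntegral_mono' measurableSet_Ioi fun s hs => ?_
        rw [weight (ht.trans hs), ENNReal.mul_rpow_of_nonneg _ _ hr.le, ← mul_assoc,
          mul_comm (ω t ^ r)]
        gcongr
        exact hω (le_of_lt hs)
    _ ≤ _ := lintegral_mono_set (Set.Ioi_subset_Ioi ht.le)

-- The sharp constant here is `(θ r) ^ (1 / r)`; the factor `2 e` is the one of `cFrac`.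
theorem le_lintegral_rpow_of_monotone {ω : ℝ → ℝ≥0∞} (hω : Monotone ω) {θ r t : ℝ}
    (hθ : 0 < θ) (hr : 0 < r) (ht : 0 < t) :
    ω t ≤ ENNReal.ofReal ((2 * Real.exp 1 * θ * r) ^ (1 / r) * t ^ θ) *
      (∫⁻ s in Set.Ioi (0 : ℝ),
        (ENNReal.ofReal (s ^ (-θ)) * ω s) ^ r * ENNReal.ofReal (1 / s)) ^ (1 / r) := by
  set I := ∫⁻ s in Set.Ioi (0 : ℝ),
    (ENNReal.ofReal (s ^ (-θ)) * ω s) ^ r * ENNReal.ofReal (1 / s)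
  have hθr : 0 < θ * r := mul_pos hθ hr
  have cancel : θ * r * t ^ (θ * r) * (t ^ (-(θ * r)) / (θ * r)) = 1 := by
    rw [Real.rpow_neg ht.le]; field_simp
  have slack : θ * r ≤ 2 * Real.exp 1 * θ * r := by
    nlinarith [Real.add_one_le_exp (1 : ℝ)]
  have ω_rpow_le : ω t ^ r ≤ ENNReal.ofReal (2 * Real.exp 1 * θ * r * t ^ (θ * r)) * I :=
    calc ω t ^ r
        = ENNReal.ofReal (θ * r * t ^ (θ * r)) *
            (ω t ^ r * ENNReal.ofReal (t ^ (-(θ * r)) / (θ * r))) := by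
          rw [mul_left_comm, ← ENNReal.ofReal_mul (by positivity), cancel, ENNReal.ofReal_one,
            mul_one]
      _ ≤ ENNReal.ofReal (2 * Real.exp 1 * θ * r * t ^ (θ * r)) * I := by
          gcongr
          exact rpow_mul_le_lintegral_of_monotone hω hθ hr ht
  calc ω t = (ω t ^ r) ^ (1 / r) := by
        rw [← ENNReal.rpow_mul, mul_one_div_cancel hr.ne', ENNReal.rpow_one]
    _ ≤ (ENNReal.ofReal (2 * Real.exp 1 * θ * r * t ^ (θ * r)) * I) ^ (1 / r) := by gcongr
    _ = _ := by
        rw [ENNReal.mul_rpow_of_nonneg _ _ (by positivity),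
          ENNReal.ofReal_rpow_of_nonneg (by positivity) (by positivity),
          Real.mul_rpow (by positivity) (by positivity), ← Real.rpow_mul ht.le, mul_assoc θ r,
          mul_one_div_cancel hr.ne', mul_one]

theorem modulus_mono (p : ℝ≥0∞) (f : Plane → ℝ) : Monotone (modulus p f) :=
  fun _ _ hst => iSup_mono fun _ => iSup_le fun hh => le_iSup_of_le (hh.trans hst) le_rfl

theorem eLpNorm_translate_sub_le_modulus (p : ℝ≥0∞) (f : Plane → ℝ) (h : Plane) :
    eLpNorm (fun x => f (x - h) - f x) p volume ≤ modulus p f ‖h‖ :=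
  le_iSup₂_of_le (f := fun (h' : Plane) (_ : ‖h'‖ ≤ ‖h‖) =>
    eLpNorm (fun x => f (x - h') - f x) p volume) h le_rfl le_rfl

theorem modulus_le_cFrac_mul_fracSeminorm {θ : ℝ} (hθ : 0 < θ) (p : ℝ≥0∞) {q : ℝ≥0∞} (hq : 1 ≤ q)
    (f : Plane → ℝ) {t : ℝ} (ht : 0 < t) :
    modulus p f t ≤ ENNReal.ofReal (cFrac θ q * t ^ θ) * fracSeminorm θ p q f := by
  unfold fracSeminorm cFrac
  split_ifs with hq_top
  · calc modulus p f t
        = ENNReal.ofReal (1 * t ^ θ) * (ENNReal.ofReal (t ^ (-θ)) * modulus p f t) := by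
          rw [← mul_assoc, ← ENNReal.ofReal_mul (by positivity), one_mul, ← Real.rpow_add ht,
            add_neg_cancel, Real.rpow_zero, ENNReal.ofReal_one, one_mul]
      _ ≤ _ := by
          gcongr
          exact le_iSup₂_of_le (f := fun (t : ℝ) (_ : 0 < t) =>
            ENNReal.ofReal (t ^ (-θ)) * modulus p f t) t ht le_rfl
  · have hr : 0 < q.toReal := ENNReal.toReal_pos (zero_lt_one.trans_le hq).ne' hq_top
    exact le_lintegral_rpow_of_monotone (modulus_mono p f) hθ hr ht

theorem eLpNorm_translate_sub_le {θ : ℝ} (hθ : 0 < θ) (p : ℝ≥0∞) {q : ℝ≥0∞} (hq : 1 ≤ q)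
    (f : Plane → ℝ) (h : Plane) :
    eLpNorm (fun x => f (x - h) - f x) p volume ≤
      ENNReal.ofReal (cFrac θ q * ‖h‖ ^ θ) * fracSeminorm θ p q f := by
  rcases eq_or_ne h 0 with rfl | hh
  · simp
  · exact (eLpNorm_translate_sub_le_modulus p f h).trans
      (modulus_le_cFrac_mul_fracSeminorm hθ p hq f (norm_pos_iff.2 hh))

theorem cFrac_nonneg {θ : ℝ} (hθ : 0 < θ) (q : ℝ≥0∞) : 0 ≤ cFrac θ q := by
  unfold cFrac
  split_ifs <;> positivity

end Modulus

section PartialDerivatives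

open scoped ContDiff

variable {u : Plane → ℝ}

theorem contDiff_partialD (hu : ContDiff ℝ ∞ u) (i : Fin 2) : ContDiff ℝ ∞ (partialD i u) :=
  (hu.fderiv_right (m := ∞) (by simp)).clm_apply contDiff_const

theorem contDiff_iterate_partialD (hu : ContDiff ℝ ∞ u) (i : Fin 2) (k : ℕ) :
    ContDiff ℝ ∞ ((partialD i)^[k] u) := by
  induction k with
  | zero => exact hu
  | succ k ih => rw [Function.iterate_succ_apply']; exact contDiff_partialD ih i

theorem contDiff_multiD (hu : ContDiff ℝ ∞ u) (j : ℕ × ℕ) : ContDiff ℝ ∞ (multiD j u) :=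
  contDiff_iterate_partialD (contDiff_iterate_partialD hu 1 j.2) 0 j.1

theorem partialD_comm (hu : ContDiff ℝ 2 u) (i k : Fin 2) :
    partialD i (partialD k u) = partialD k (partialD i u) := by
  have second_fderiv (a b : Fin 2) (x : Plane) : partialD a (partialD b u) x =
      fderiv ℝ (fderiv ℝ u) x (EuclideanSpace.single a 1) (EuclideanSpace.single b 1) := by
    have hd : DifferentiableAt ℝ (fderiv ℝ u) x :=
      (hu.fderiv_right (m := 1) (by norm_num)).differentiable (by simp) x
    unfold partialD
    rw [fderiv_clm_apply hd (differentiableAt_const _)]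
    simp
  funext x
  rw [second_fderiv, second_fderiv]
  exact hu.contDiffAt.isSymmSndFDerivAt (by simp) _ _

theorem partialD_iterate_partialD (hu : ContDiff ℝ ∞ u) (i k : Fin 2) (m : ℕ) :
    partialD i ((partialD k)^[m] u) = (partialD k)^[m] (partialD i u) := by
  induction m with
  | zero => rfl
  | succ m ih =>
    rw [Function.iterate_succ_apply', Function.iterate_succ_apply', ← ih,
      partialD_comm ((contDiff_iterate_partialD hu k m).of_le
        (WithTop.coe_le_coe.2 (le_top : (2 : ℕ∞) ≤ ⊤)))]

theorem partialD_zero_multiD (u : Plane → ℝ) (a b : ℕ) :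
    partialD 0 (multiD (a, b) u) = multiD (a + 1, b) u :=
  (Function.iterate_succ_apply' (partialD 0) a _).symm

theorem partialD_one_multiD (hu : ContDiff ℝ ∞ u) (a b : ℕ) :
    partialD 1 (multiD (a, b) u) = multiD (a, b + 1) u := by
  unfold multiD
  rw [partialD_iterate_partialD (contDiff_iterate_partialD hu 1 b), Function.iterate_succ_apply']

theorem hasCompactSupport_partialD (hu : HasCompactSupport u) (i : Fin 2) :
    HasCompactSupport (partialD i u) :=
  (hu.fderiv (𝕜 := ℝ)).comp_left (g := fun A : Plane →L[ℝ] ℝ => A (EuclideanSpace.single i 1)) rfl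

theorem hasCompactSupport_iterate_partialD (hu : HasCompactSupport u) (i : Fin 2) (k : ℕ) :
    HasCompactSupport ((partialD i)^[k] u) := by
  induction k with
  | zero => exact hu
  | succ k ih => rw [Function.iterate_succ_apply']; exact hasCompactSupport_partialD ih i

theorem partialD_const_mul (u : Plane → ℝ) (c : ℝ) (i : Fin 2) :
    partialD i (fun y => c * u y) = fun y => c * partialD i u y := by
  funext y
  change fderiv ℝ (c • u) y _ = _
  rw [fderiv_const_smul_field]
  rfl

theorem partialD_comp_const_sub (u : Plane → ℝ) (x : Plane) (i : Fin 2) :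
    partialD i (fun y => u (x - y)) = fun y => -partialD i u (x - y) := by
  funext y
  have reflection := (ContinuousLinearEquiv.neg ℝ (M := Plane)).comp_right_fderiv
    (f := fun z => u (x + z)) (x := y)
  have translation := fderiv_comp_add_left (𝕜 := ℝ) (f := u) (x := -y) x
  simp only [Function.comp_def, ContinuousLinearEquiv.coe_neg, Pi.neg_apply, id,
    ← sub_eq_add_neg] at reflection translation
  simp [partialD, reflection, translation]

theorem iterate_partialD_comp_const_sub (u : Plane → ℝ) (x : Plane) (i : Fin 2) (c : ℝ) (k : ℕ) :
    (partialD i)^[k] (fun y => c * u (x - y)) =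
      fun y => (-1) ^ k * c * (partialD i)^[k] u (x - y) := by
  induction k with
  | zero => simp
  | succ k ih =>
    rw [Function.iterate_succ_apply', ih,
      partialD_const_mul (fun y => (partialD i)^[k] u (x - y)), partialD_comp_const_sub,
      Function.iterate_succ_apply']
    funext y
    ring

theorem multiD_comp_const_sub (u : Plane → ℝ) (x : Plane) (j : ℕ × ℕ) :
    multiD j (fun y => u (x - y)) = fun y => (-1) ^ (j.1 + j.2) * multiD j u (x - y) := by
  have inner := iterate_partialD_comp_const_sub u x 1 1 j.2
  simp only [one_mul, mul_one] at inner
  unfold multiD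
  rw [inner, iterate_partialD_comp_const_sub, pow_add]

end PartialDerivatives

section Mollification

open scoped ContDiff Convolution

theorem partialD_convolution {ρ f : Plane → ℝ} (hρ : ContDiff ℝ 1 ρ) (hc : HasCompactSupport ρ)
    (hf : LocallyIntegrable f volume) (i : Fin 2) :
    partialD i (ρ ⋆[ContinuousLinearMap.lsmul ℝ ℝ] f) =
      partialD i ρ ⋆[ContinuousLinearMap.lsmul ℝ ℝ] f := by
  funext x
  have hderiv := hc.hasFDerivAt_convolution_left (ContinuousLinearMap.lsmul ℝ ℝ) hρ hf x
  have hexists := (hc.fderiv (𝕜 := ℝ)).convolutionExists_left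
    ((ContinuousLinearMap.lsmul ℝ ℝ : ℝ →L[ℝ] ℝ →L[ℝ] ℝ).precompL Plane)
    (hρ.continuous_fderiv (by simp)) hf x
  rw [partialD, hderiv.fderiv, convolution_def, ContinuousLinearMap.integral_apply hexists]
  simp [convolution_def, partialD]

theorem iterate_partialD_convolution {ρ f : Plane → ℝ} (hρ : ContDiff ℝ ∞ ρ)
    (hc : HasCompactSupport ρ) (hf : LocallyIntegrable f volume) (i : Fin 2) (k : ℕ) :
    (partialD i)^[k] (ρ ⋆[ContinuousLinearMap.lsmul ℝ ℝ] f) =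
      (partialD i)^[k] ρ ⋆[ContinuousLinearMap.lsmul ℝ ℝ] f := by
  induction k with
  | zero => rfl
  | succ k ih =>
    rw [Function.iterate_succ_apply', Function.iterate_succ_apply', ih,
      partialD_convolution ((contDiff_iterate_partialD hρ i k).of_le (by simp))
        (hasCompactSupport_iterate_partialD hc i k) hf]

theorem multiD_convolution {ρ f : Plane → ℝ} (hρ : ContDiff ℝ ∞ ρ)
    (hc : HasCompactSupport ρ) (hf : LocallyIntegrable f volume) (j : ℕ × ℕ) :
    multiD j (ρ ⋆[ContinuousLinearMap.lsmul ℝ ℝ] f) =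
      multiD j ρ ⋆[ContinuousLinearMap.lsmul ℝ ℝ] f := by
  unfold multiD
  rw [iterate_partialD_convolution hρ hc hf, iterate_partialD_convolution
    (contDiff_iterate_partialD hρ 1 j.2) (hasCompactSupport_iterate_partialD hc 1 j.2) hf]

theorem HasWeakDeriv.multiD_convolution {ρ f g : Plane → ℝ} {j : ℕ × ℕ} (hg : HasWeakDeriv j f g)
    (hρ : ContDiff ℝ ∞ ρ) (hc : HasCompactSupport ρ) (hf : LocallyIntegrable f volume) :
    multiD j (ρ ⋆[ContinuousLinearMap.lsmul ℝ ℝ] f) = ρ ⋆[ContinuousLinearMap.lsmul ℝ ℝ] g := by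
  funext x
  have sign_sq : ((-1 : ℝ) ^ (j.1 + j.2)) * (-1) ^ (j.1 + j.2) = 1 := by
    rw [← mul_pow, neg_one_mul, neg_neg, one_pow]
  have htest := hg.2 (fun y => ρ (x - y)) (hρ.comp (contDiff_const.sub contDiff_id))
    (hc.comp_homeomorph (Homeomorph.subLeft x))
  rw [multiD_comp_const_sub] at htest
  rw [FBP.multiD_convolution hρ hc hf, convolution_lsmul_swap, convolution_lsmul_swap]
  calc ∫ y, multiD j ρ (x - y) • f y
      = (-1) ^ (j.1 + j.2) * ∫ y, f y * ((-1) ^ (j.1 + j.2) * multiD j ρ (x - y)) := by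
        rw [← integral_const_mul]
        refine integral_congr_ae (ae_of_all _ fun y => ?_)
        simp only [smul_eq_mul]
        linear_combination (-(f y * multiD j ρ (x - y))) * sign_sq
    _ = ∫ y, g y * ρ (x - y) := by rw [htest, ← mul_assoc, sign_sq, one_mul]
    _ = ∫ y, ρ (x - y) • g y := by simp only [smul_eq_mul, mul_comm]

variable {E F : Type*} [NormedAddCommGroup E] [LocallyCompactSpace E]
  [SecondCountableTopology E] [MeasurableSpace E] [BorelSpace E] [NormedAddCommGroup F]
  [NormedSpace ℝ F] {μ : Measure E} [μ.IsAddHaarMeasure] {ρ : E → ℝ} {g : E → F}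

theorem convolution_translate_sub_convolution (hρ : Continuous ρ) (hc : HasCompactSupport ρ)
    (hg : LocallyIntegrable g μ) (h x : E) :
    (ρ ⋆[ContinuousLinearMap.lsmul ℝ ℝ, μ] g) (x - h) -
      (ρ ⋆[ContinuousLinearMap.lsmul ℝ ℝ, μ] g) x =
      ∫ y, ρ y • (g (x - y - h) - g (x - y)) ∂μ := by
  have hex (x : E) : Integrable (fun y => ρ y • g (x - y)) μ :=
    hc.convolutionExists_left (ContinuousLinearMap.lsmul ℝ ℝ) hρ hg x
  rw [convolution_lsmul, convolution_lsmul, ← integral_sub (hex (x - h)) (hex x)]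
  simp only [smul_sub, sub_right_comm x h]

theorem eLpNorm_translate_sub_convolution_le (hρ : Continuous ρ) (hc : HasCompactSupport ρ)
    (hρ_nonneg : ∀ x, 0 ≤ ρ x) (hρ_one : ∫ x, ρ x ∂μ = 1) (hg : LocallyIntegrable g μ)
    {p : ℝ≥0∞} (hp : 1 ≤ p) (h : E) :
    eLpNorm (fun x => (ρ ⋆[ContinuousLinearMap.lsmul ℝ ℝ, μ] g) (x - h) -
      (ρ ⋆[ContinuousLinearMap.lsmul ℝ ℝ, μ] g) x) p μ ≤
      eLpNorm (fun x => g (x - h) - g x) p μ := by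
  have hg_diff : AEStronglyMeasurable (fun x => g (x - h) - g x) μ :=
    (hg.aestronglyMeasurable.comp_measurePreserving (measurePreserving_sub_right μ h)).sub
      hg.aestronglyMeasurable
  simp only [convolution_translate_sub_convolution hρ hc hg h]
  calc eLpNorm (fun x => ∫ y, ρ y • (g (x - y - h) - g (x - y)) ∂μ) p μ
      ≤ ∫⁻ y, ENNReal.ofReal (ρ y) * eLpNorm (fun x => g (x - h) - g x) p μ ∂μ := by
        refine eLpNorm_integral_le hp ?_ (hρ.measurable.ennreal_ofReal.mul_const _).aemeasurable
          (ae_of_all _ fun y => ?_)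
        · exact (hρ.comp continuous_snd).aestronglyMeasurable.smul
            (hg_diff.comp_quasiMeasurePreserving (quasiMeasurePreserving_sub μ μ))
        · change eLpNorm (ρ y • fun x => g (x - y - h) - g (x - y)) p μ ≤ _
          rw [eLpNorm_const_smul, Real.enorm_of_nonneg (hρ_nonneg y)]
          gcongr
          exact (eLpNorm_comp_measurePreserving hg_diff (measurePreserving_sub_right μ y)).le
    _ = eLpNorm (fun x => g (x - h) - g x) p μ := by
        rw [lintegral_mul_const _ hρ.measurable.ennreal_ofReal,
          ← ofReal_integral_eq_lintegral_ofReal (hρ.integrable_of_hasCompactSupport hc)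
            (ae_of_all _ hρ_nonneg), hρ_one, ENNReal.ofReal_one, one_mul]

end Mollification

section Taylor

open scoped ContDiff Nat
open Finset.HasAntidiagonal (antidiagonal mem_antidiagonal)

/-- The `k`-th derivative of `u` at `x` in the direction `v`, written through the binomial formula
in terms of the partial derivatives `multiD j u`, the form in which they enter `besovSeminorm`. -/
noncomputable def dirDeriv (k : ℕ) (u : Plane → ℝ) (x v : Plane) : ℝ :=
  ∑ j ∈ antidiagonal k, (k.choose j.1 : ℝ) * (v 0 ^ j.1 * v 1 ^ j.2 * multiD j u x)

/-- The remainder of the Taylor polynomial of degree `n` of `u` at `x`, evaluated at `x + v`. -/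
noncomputable def taylorRem (n : ℕ) (u : Plane → ℝ) (x v : Plane) : ℝ :=
  u (x + v) - ∑ k ∈ Finset.range (n + 1), dirDeriv k u x v / k !

@[simp]
theorem dirDeriv_zero (u : Plane → ℝ) (x v : Plane) : dirDeriv 0 u x v = u x := by
  simp [dirDeriv, multiD]

theorem fderiv_apply_eq_partialD (u : Plane → ℝ) (x v : Plane) :
    fderiv ℝ u x v = v 0 * partialD 0 u x + v 1 * partialD 1 u x := by
  have hv : v = v 0 • EuclideanSpace.single (0 : Fin 2) (1 : ℝ) +
      v 1 • EuclideanSpace.single (1 : Fin 2) (1 : ℝ) := by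
    ext i; fin_cases i <;> simp
  conv_lhs => rw [hv, map_add, map_smul, map_smul]
  rfl

theorem integral_one_sub_pow_div_factorial (m : ℕ) :
    ∫ s in (0 : ℝ)..1, (1 - s) ^ m / m ! = 1 / (m + 1)! := by
  rw [intervalIntegral.integral_div, intervalIntegral.integral_comp_sub_left (fun s => s ^ m),
    integral_pow, Nat.factorial_succ]
  simp [div_eq_mul_inv, mul_comm]

theorem lintegral_one_sub_pow_mul_rpow {θ : ℝ} (hθ : -1 < θ) (m : ℕ) :
    ∫⁻ s in Set.Ioc (0 : ℝ) 1, ENNReal.ofReal ((1 - s) ^ m * s ^ θ) =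
      ENNReal.ofReal (m ! * Real.Gamma (θ + 1) / Real.Gamma (m + 1 + θ + 1)) := by
  set B := ProbabilityTheory.beta (θ + 1) (m + 1) with hB
  have hBpos : 0 < B := ProbabilityTheory.beta_pos (by linarith) (by positivity)
  have density : ∫⁻ s in Set.Ioc (0 : ℝ) 1, ENNReal.ofReal ((1 - s) ^ m * s ^ θ) =
      ENNReal.ofReal B * ∫⁻ s, ProbabilityTheory.betaPDF (θ + 1) (m + 1) s := by
    rw [ProbabilityTheory.lintegral_betaPDF, ← lintegral_const_mul _ (by fun_prop),
      setLIntegral_congr (Ioo_ae_eq_Ioc (μ := volume)).symm]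
    refine lintegral_congr fun s => ?_
    rw [← ENNReal.ofReal_mul hBpos.le, ← hB]
    congr 1
    simp only [add_sub_cancel_right, Real.rpow_natCast]
    field_simp
  rw [density, ProbabilityTheory.lintegral_betaPDF_eq_one (by linarith) (by positivity), mul_one,
    hB, ProbabilityTheory.beta, Real.Gamma_nat_eq_factorial]
  congr 2
  · ring
  · congr 1; ring

theorem abs_monomial_le_norm_pow (v : Plane) (j : ℕ × ℕ) :
    |v 0 ^ j.1 * v 1 ^ j.2| ≤ ‖v‖ ^ (j.1 + j.2) := by
  rw [abs_mul, abs_pow, abs_pow, pow_add]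
  gcongr
  · exact PiLp.norm_apply_le v 0
  · exact PiLp.norm_apply_le v 1

variable {u : Plane → ℝ} (hu : ContDiff ℝ ∞ u)
include hu

theorem continuous_dirDeriv (k : ℕ) :
    Continuous (fun z : Plane × Plane => dirDeriv k u z.1 z.2) := by
  unfold dirDeriv
  refine continuous_finsetSum _ fun j _ => ?_
  have := (contDiff_multiD hu j).continuous
  fun_prop

theorem continuous_taylorRem (n : ℕ) :
    Continuous (fun z : Plane × Plane => taylorRem n u z.1 z.2) :=
  (hu.continuous.comp (by fun_prop)).sub
    (continuous_finsetSum _ fun k _ => (continuous_dirDeriv hu k).div_const _)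

theorem hasDerivAt_multiD_line (j : ℕ × ℕ) (x v : Plane) (s : ℝ) :
    HasDerivAt (fun s : ℝ => multiD j u (x + s • v))
      (v 0 * multiD (j.1 + 1, j.2) u (x + s • v) +
        v 1 * multiD (j.1, j.2 + 1) u (x + s • v)) s := by
  have line : HasDerivAt (fun s : ℝ => x + s • v) v s := by
    simpa using ((hasDerivAt_id s).smul_const v).const_add x
  have chain := ((contDiff_multiD hu j).differentiable (by simp)
    (x + s • v)).hasFDerivAt.comp_hasDerivAt s line
  rwa [fderiv_apply_eq_partialD, partialD_zero_multiD, partialD_one_multiD hu] at chain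

theorem hasDerivAt_dirDeriv (x v : Plane) (k : ℕ) (s : ℝ) :
    HasDerivAt (fun s : ℝ => dirDeriv k u (x + s • v) v)
      (dirDeriv (k + 1) u (x + s • v) v) s := by
  have termwise := HasDerivAt.fun_sum (u := antidiagonal k) fun j _ =>
    ((hasDerivAt_multiD_line hu j x v s).const_mul (v 0 ^ j.1 * v 1 ^ j.2)).const_mul
      (k.choose j.1 : ℝ)
  refine termwise.congr_deriv ?_
  unfold dirDeriv
  rw [Finset.sum_antidiagonal_choose_succ_mul
    (fun a b => v 0 ^ a * v 1 ^ b * multiD (a, b) u (x + s • v)), ← Finset.sum_add_distrib]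
  refine Finset.sum_congr rfl fun j hj => ?_
  rw [mem_antidiagonal] at hj
  rw [show k.choose j.2 = k.choose j.1 by rw [← hj, Nat.choose_symm_add]]
  ring

theorem iteratedDeriv_line (x v : Plane) (k : ℕ) :
    iteratedDeriv k (fun s : ℝ => u (x + s • v)) = fun s => dirDeriv k u (x + s • v) v := by
  induction k with
  | zero => simp
  | succ k ih =>
    rw [iteratedDeriv_succ, ih]
    exact funext fun s => (hasDerivAt_dirDeriv hu x v k s).deriv

theorem taylor_dirDeriv (m : ℕ) (x v : Plane) :
    u (x + v) = ∑ k ∈ Finset.range (m + 1), dirDeriv k u x v / k ! +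
      ∫ s in (0 : ℝ)..1, (1 - s) ^ m / m ! * dirDeriv (m + 1) u (x + s • v) v := by
  have smooth : ContDiff ℝ ∞ (fun s : ℝ => u (x + s • v)) := hu.comp (by fun_prop)
  have within {s : ℝ} (hs : s ∈ Set.uIcc 0 1) (k : ℕ) :
      iteratedDerivWithin k (fun s : ℝ => u (x + s • v)) (Set.uIcc 0 1) s =
        dirDeriv k u (x + s • v) v := by
    rw [iteratedDerivWithin_eq_iteratedDeriv (uniqueDiffOn_uIcc zero_ne_one)
      (smooth.contDiffAt.of_le (by exact_mod_cast le_top)) hs, iteratedDeriv_line hu]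
  have taylor := taylor_integral_remainder (n := m) (x₀ := 0) (x := 1)
    (f := fun s : ℝ => u (x + s • v)) (smooth.contDiffOn.of_le (by exact_mod_cast le_top))
  rw [taylor_within_apply, intervalIntegral.integral_congr fun s hs =>
    congrArg (((1 - s) ^ m / m !) • ·) (within hs (m + 1))] at taylor
  simp only [within Set.left_mem_uIcc, one_smul, zero_smul, add_zero, sub_zero, one_pow, mul_one,
    smul_eq_mul, inv_mul_eq_div] at taylor
  exact sub_eq_iff_eq_add'.1 taylor

theorem taylorRem_succ (m : ℕ) (x v : Plane) :
    taylorRem (m + 1) u x v = ∫ s in Set.Ioc (0 : ℝ) 1,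
      (1 - s) ^ m / m ! * (dirDeriv (m + 1) u (x + s • v) v - dirDeriv (m + 1) u x v) := by
  have hc : Continuous fun s : ℝ => dirDeriv (m + 1) u (x + s • v) v :=
    (continuous_dirDeriv hu (m + 1)).comp (f := fun s : ℝ => (x + s • v, v)) (by fun_prop)
  rw [← intervalIntegral.integral_of_le zero_le_one]
  simp only [mul_sub]
  rw [intervalIntegral.integral_sub (Continuous.intervalIntegrable (by fun_prop) _ _)
      (Continuous.intervalIntegrable (by fun_prop) _ _), intervalIntegral.integral_mul_const,
    integral_one_sub_pow_div_factorial, taylorRem, Finset.sum_range_succ, taylor_dirDeriv hu m x v]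
  ring

variable {p : ℝ≥0∞} (hp : 1 ≤ p)
include hp

theorem eLpNorm_dirDeriv_sub_le {n : ℕ} {h : Plane} {N : ℕ × ℕ → ℝ≥0∞}
    (hN : ∀ j ∈ antidiagonal n,
      eLpNorm (fun x => multiD j u (x - h) - multiD j u x) p volume ≤ N j) (v : Plane) :
    eLpNorm (fun x => dirDeriv n u (x - h) v - dirDeriv n u x v) p volume ≤
      ENNReal.ofReal (‖v‖ ^ n) * ∑ j ∈ antidiagonal n, (n.choose j.1 : ℝ≥0∞) * N j := by
  have expand : (fun x => dirDeriv n u (x - h) v - dirDeriv n u x v) =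
      ∑ j ∈ antidiagonal n, ((n.choose j.1 : ℝ) * (v 0 ^ j.1 * v 1 ^ j.2)) •
        fun x => multiD j u (x - h) - multiD j u x := by
    funext x
    simp only [dirDeriv, Finset.sum_apply, Pi.smul_apply, smul_eq_mul]
    rw [← Finset.sum_sub_distrib]
    exact Finset.sum_congr rfl fun j _ => by ring
  rw [expand]
  refine (eLpNorm_sum_le (fun j _ => ?_) hp).trans ?_
  · have := (contDiff_multiD hu j).continuous
    exact (Continuous.aestronglyMeasurable (by fun_prop)).const_smul _
  rw [Finset.mul_sum]
  refine Finset.sum_le_sum fun j hj => ?_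
  rw [eLpNorm_const_smul, Real.enorm_eq_ofReal_abs, abs_mul, ENNReal.ofReal_mul (abs_nonneg _),
    Nat.abs_cast, ENNReal.ofReal_natCast]
  have monomial : |v 0 ^ j.1 * v 1 ^ j.2| ≤ ‖v‖ ^ n :=
    mem_antidiagonal.1 hj ▸ abs_monomial_le_norm_pow v j
  rw [← mul_assoc (ENNReal.ofReal _), mul_comm (ENNReal.ofReal _)]
  gcongr
  exact hN j hj

variable {θ c : ℝ} {N : ℕ × ℕ → ℝ≥0∞}

theorem eLpNorm_taylorRem_succ_integrand_le {m : ℕ}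
    (hN : ∀ j ∈ antidiagonal (m + 1), ∀ h : Plane,
      eLpNorm (fun x => multiD j u (x - h) - multiD j u x) p volume ≤
        ENNReal.ofReal (c * ‖h‖ ^ θ) * N j) (v : Plane) {s : ℝ} (hs : s ∈ Set.Ioc 0 1) :
    eLpNorm (fun x => (1 - s) ^ m / m ! *
      (dirDeriv (m + 1) u (x + s • v) v - dirDeriv (m + 1) u x v)) p volume ≤
      ENNReal.ofReal ((1 - s) ^ m * s ^ θ) *
        (ENNReal.ofReal (‖v‖ ^ (m + 1) * (c * ‖v‖ ^ θ) / m !) *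
          ∑ j ∈ antidiagonal (m + 1), ((m + 1).choose j.1 : ℝ≥0∞) * N j) := by
  have weight_nonneg : 0 ≤ (1 - s) ^ m := pow_nonneg (by linarith [hs.2]) _
  have difference := eLpNorm_dirDeriv_sub_le hu hp (fun j hj => hN j hj (-(s • v))) v
  simp_rw [mul_left_comm _ (ENNReal.ofReal _), ← Finset.mul_sum, sub_neg_eq_add, norm_neg,
    norm_smul, Real.norm_eq_abs, abs_of_pos hs.1] at difference
  change eLpNorm (((1 - s) ^ m / m !) • fun x => dirDeriv (m + 1) u (x + s • v) v -
    dirDeriv (m + 1) u x v) p volume ≤ _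
  rw [eLpNorm_const_smul, Real.enorm_of_nonneg (by positivity)]
  refine (mul_le_mul_right difference _).trans_eq ?_
  simp only [← mul_assoc]
  rw [← ENNReal.ofReal_mul (by positivity), ← ENNReal.ofReal_mul (by positivity),
    ← ENNReal.ofReal_mul (mul_nonneg weight_nonneg (Real.rpow_nonneg hs.1.le _)),
    Real.mul_rpow hs.1.le (norm_nonneg _)]
  congr 2
  ring

theorem eLpNorm_taylorRem_succ_le (hθ : 0 ≤ θ) {m : ℕ}
    (hN : ∀ j ∈ antidiagonal (m + 1), ∀ h : Plane,
      eLpNorm (fun x => multiD j u (x - h) - multiD j u x) p volume ≤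
        ENNReal.ofReal (c * ‖h‖ ^ θ) * N j) (v : Plane) :
    eLpNorm (fun x => taylorRem (m + 1) u x v) p volume ≤
      ENNReal.ofReal (c * (Real.Gamma (θ + 1) / Real.Gamma (m + 1 + θ + 1)) *
        ‖v‖ ^ (m + 1 + θ)) *
        ∑ j ∈ antidiagonal (m + 1), ((m + 1).choose j.1 : ℝ≥0∞) * N j := by
  have translated : Continuous fun z : Plane × ℝ => dirDeriv (m + 1) u (z.1 + z.2 • v) v :=
    (continuous_dirDeriv hu (m + 1)).comp (f := fun z : Plane × ℝ => (z.1 + z.2 • v, v))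
      (by fun_prop)
  have fixed : Continuous fun z : Plane × ℝ => dirDeriv (m + 1) u z.1 v :=
    (continuous_dirDeriv hu (m + 1)).comp (f := fun z : Plane × ℝ => (z.1, v)) (by fun_prop)
  simp only [taylorRem_succ hu]
  refine (eLpNorm_integral_le hp ?_ (Measurable.mul_const (by fun_prop) _).aemeasurable
    ((ae_restrict_mem measurableSet_Ioc).mono fun s hs =>
      eLpNorm_taylorRem_succ_integrand_le hu hp hN v hs)).trans_eq ?_
  · refine Continuous.aestronglyMeasurable ?_
    simp only [Function.uncurry_def]
    fun_prop
  · rw [lintegral_mul_const _ (by fun_prop), lintegral_one_sub_pow_mul_rpow (by linarith),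
      ← mul_assoc, ← ENNReal.ofReal_mul (by positivity)]
    congr 2
    rw [Real.rpow_add_of_nonneg (norm_nonneg _) (by positivity) hθ, ← Nat.cast_succ,
      Real.rpow_natCast]
    field_simp

theorem eLpNorm_taylorRem_le (hθ : 0 ≤ θ) {n : ℕ}
    (hN : ∀ j ∈ antidiagonal n, ∀ h : Plane,
      eLpNorm (fun x => multiD j u (x - h) - multiD j u x) p volume ≤
        ENNReal.ofReal (c * ‖h‖ ^ θ) * N j) (v : Plane) :
    eLpNorm (fun x => taylorRem n u x v) p volume ≤
      ENNReal.ofReal (c * (Real.Gamma (θ + 1) / Real.Gamma (n + θ + 1)) * ‖v‖ ^ (n + θ)) *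
        ∑ j ∈ antidiagonal n, (n.choose j.1 : ℝ≥0∞) * N j := by
  cases n with
  | zero =>
    have hΓ : Real.Gamma (θ + 1) ≠ 0 := (Real.Gamma_pos_of_pos (by linarith)).ne'
    simpa [taylorRem, multiD, hΓ] using hN (0, 0) (by simp) (-v)
  | succ m => simpa using eLpNorm_taylorRem_succ_le hu hp hθ hN v

end Taylor

section Approximation

open scoped ContDiff Nat Convolution
open Finset.HasAntidiagonal (antidiagonal mem_antidiagonal)

theorem pow_le_one_add_rpow {t α : ℝ} (ht : 0 ≤ t) {m : ℕ} (hm : (m : ℝ) ≤ α) :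
    t ^ m ≤ 1 + t ^ α := by
  rcases le_total t 1 with h | h
  · exact (pow_le_one₀ ht h).trans (le_add_of_nonneg_right (Real.rpow_nonneg ht α))
  · have := Real.rpow_le_rpow_of_exponent_le h hm
    rw [Real.rpow_natCast] at this
    linarith

theorem integrable_monomial_smul {E : Type*} [NormedAddCommGroup E] [NormedSpace ℝ E]
    {k : Plane → E} {α : ℝ} (hk : Integrable k volume)
    (hkα : Integrable (fun x : Plane => ‖x‖ ^ α * ‖k x‖) volume) {j : ℕ × ℕ}
    (hj : ((j.1 + j.2 : ℕ) : ℝ) ≤ α) :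
    Integrable (fun x : Plane => (x 0 ^ j.1 * x 1 ^ j.2) • k x) volume := by
  refine (hk.norm.add hkα).mono' ?_ (ae_of_all _ fun x => ?_)
  · have monomial_continuous : Continuous fun x : Plane => x 0 ^ j.1 * x 1 ^ j.2 := by fun_prop
    exact monomial_continuous.aestronglyMeasurable.smul hk.aestronglyMeasurable
  · calc ‖(x 0 ^ j.1 * x 1 ^ j.2) • k x‖ = |x 0 ^ j.1 * x 1 ^ j.2| * ‖k x‖ := norm_smul _ _
      _ ≤ (1 + ‖x‖ ^ α) * ‖k x‖ := by
        gcongr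
        exact (abs_monomial_le_norm_pow x j).trans (pow_le_one_add_rpow (norm_nonneg x) hj)
      _ = ‖k x‖ + ‖x‖ ^ α * ‖k x‖ := by ring

theorem mul_dirDeriv_neg (k : Plane → ℂ) (u : Plane → ℝ) (i : ℕ) (x y : Plane) :
    k y * (dirDeriv i u x (-y) : ℂ) = ∑ j ∈ antidiagonal i,
      ((i.choose j.1 * ((-1) ^ i * multiD j u x) : ℝ) : ℂ) * ((y 0 ^ j.1 * y 1 ^ j.2) • k y) := by
  rw [dirDeriv, Complex.ofReal_sum, Finset.mul_sum]
  refine Finset.sum_congr rfl fun j hj => ?_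
  rw [← mem_antidiagonal.1 hj, pow_add, Complex.real_smul]
  simp only [PiLp.neg_apply]
  rw [neg_pow (y 0), neg_pow (y 1)]
  push_cast
  ring

section Kernel

variable {k : Plane → ℂ} (hk : Integrable k volume)
include hk

section Moments

variable {α : ℝ} (hkα : Integrable (fun x : Plane => ‖x‖ ^ α * ‖k x‖) volume)
include hkα

theorem integrable_mul_dirDeriv_neg {i : ℕ} (hi : (i : ℝ) ≤ α) (u : Plane → ℝ) (x : Plane) :
    Integrable (fun y => k y * (dirDeriv i u x (-y) : ℂ)) volume := by
  simp only [mul_dirDeriv_neg]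
  refine integrable_finsetSum _ fun j hj => (integrable_monomial_smul hk hkα ?_).const_mul _
  rwa [mem_antidiagonal.1 hj]

theorem integral_mul_dirDeriv_neg {i : ℕ} (hi : (i : ℝ) ≤ α)
    (hmom : ∀ j₁ j₂ : ℕ, j₁ + j₂ = i → ∫ x : Plane, (x 0 ^ j₁ * x 1 ^ j₂) • k x = 0)
    (u : Plane → ℝ) (x : Plane) :
    ∫ y, k y * (dirDeriv i u x (-y) : ℂ) = 0 := by
  simp only [mul_dirDeriv_neg]
  rw [integral_finsetSum]
  · refine Finset.sum_eq_zero fun j hj => ?_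
    rw [integral_const_mul, hmom _ _ (mem_antidiagonal.1 hj), mul_zero]
  · refine fun j hj => (integrable_monomial_smul hk hkα ?_).const_mul _
    rwa [mem_antidiagonal.1 hj]

-- The vanishing moments remove every Taylor term of positive order.
theorem integral_mul_taylorRem_neg {u : Plane → ℝ} {n : ℕ} (hα : (n : ℝ) ≤ α)
    (hk1 : ∫ x, k x = 1)
    (hmom : ∀ j₁ j₂ : ℕ, 1 ≤ j₁ + j₂ → j₁ + j₂ ≤ n →
      ∫ x : Plane, (x 0 ^ j₁ * x 1 ^ j₂) • k x = 0) {x : Plane}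
    (hku : Integrable (fun y => k y * (u (x - y) : ℂ)) volume) :
    ∫ y, k y * (taylorRem n u x (-y) : ℂ) = (∫ y, k y * (u (x - y) : ℂ)) - u x := by
  have order_le (i : ℕ) (hi : i ∈ Finset.range (n + 1)) : (i : ℝ) ≤ α :=
    le_trans (by exact_mod_cast Finset.mem_range_succ_iff.1 hi) hα
  have terms_integrable (i : ℕ) (hi : i ∈ Finset.range (n + 1)) :
      Integrable (fun y => k y * (dirDeriv i u x (-y) : ℂ) / (i ! : ℂ)) volume :=
    (integrable_mul_dirDeriv_neg hk hkα (order_le i hi) u x).div_const _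
  have expand : (fun y => k y * (taylorRem n u x (-y) : ℂ)) = fun y => k y * (u (x - y) : ℂ) -
      ∑ i ∈ Finset.range (n + 1), k y * (dirDeriv i u x (-y) : ℂ) / (i ! : ℂ) := by
    funext y
    simp only [taylorRem, ← sub_eq_add_neg]
    push_cast
    rw [mul_sub, Finset.mul_sum]
    simp only [mul_div_assoc]
  rw [expand, integral_sub hku (integrable_finsetSum _ terms_integrable),
    integral_finsetSum _ terms_integrable, Finset.sum_range_succ', Finset.sum_eq_zero]
  · simp only [dirDeriv_zero]
    rw [integral_div, integral_mul_const, hk1]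
    simp
  · intro i hi
    have hi' : i + 1 ≤ n := Finset.mem_range.1 hi
    rw [integral_div, integral_mul_dirDeriv_neg hk hkα
      (order_le (i + 1) (Finset.mem_range.2 (by omega))), zero_div]
    exact fun j₁ j₂ hj => hmom j₁ j₂ (by omega) (by omega)

end Moments

variable {p : ℝ≥0∞} {n : ℕ} {θ : ℝ}
  (hkα : Integrable (fun x : Plane => ‖x‖ ^ (n + θ) * ‖k x‖) volume)
include hkα

theorem eLpNorm_integral_mul_taylorRem_neg_le {u : Plane → ℝ} (hu : ContDiff ℝ ∞ u)
    (hp : 1 ≤ p) {a : ℝ} (ha : 0 ≤ a) {S : ℝ≥0∞}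
    (hrem : ∀ v, eLpNorm (fun x => taylorRem n u x v) p volume ≤
      ENNReal.ofReal (a * ‖v‖ ^ (n + θ)) * S) :
    eLpNorm (fun x => ∫ y, k y * (taylorRem n u x (-y) : ℂ)) p volume ≤
      ENNReal.ofReal (a * ∫ x : Plane, ‖x‖ ^ (n + θ) * ‖k x‖) * S := by
  have weight_measurable :
      AEMeasurable (fun y : Plane => ENNReal.ofReal (‖y‖ ^ (n + θ) * ‖k y‖)) volume :=
    hkα.aestronglyMeasurable.aemeasurable.ennreal_ofReal
  calc eLpNorm (fun x => ∫ y, k y * (taylorRem n u x (-y) : ℂ)) p volume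
      ≤ ∫⁻ y, ENNReal.ofReal (‖y‖ ^ (n + θ) * ‖k y‖) * (ENNReal.ofReal a * S) := by
        refine eLpNorm_integral_le hp ?_ (weight_measurable.mul_const _) (ae_of_all _ fun y => ?_)
        · exact hk.aestronglyMeasurable.comp_snd.mul
            (Complex.continuous_ofReal.comp ((continuous_taylorRem hu n).comp
              (continuous_fst.prodMk continuous_snd.neg))).aestronglyMeasurable
        · have hnorm : eLpNorm (fun x => (taylorRem n u x (-y) : ℂ)) p volume =
              eLpNorm (fun x => taylorRem n u x (-y)) p volume :=
            eLpNorm_congr_norm_ae (ae_of_all _ fun x => Complex.norm_real _)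
          change eLpNorm (k y • fun x => (taylorRem n u x (-y) : ℂ)) p volume ≤ _
          rw [eLpNorm_const_smul, hnorm, ← ofReal_norm]
          refine (mul_le_mul_right (hrem (-y)) _).trans_eq ?_
          rw [norm_neg, ← mul_assoc, ← mul_assoc, ← ENNReal.ofReal_mul (by positivity),
            ← ENNReal.ofReal_mul (by positivity)]
          congr 2
          ring
    _ = ENNReal.ofReal (a * ∫ x : Plane, ‖x‖ ^ (n + θ) * ‖k x‖) * S := by
        rw [lintegral_mul_const'' _ weight_measurable, ← ofReal_integral_eq_lintegral_ofReal hkα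
          (ae_of_all _ fun y => by positivity), ENNReal.ofReal_mul ha]
        ring

theorem eLpNorm_sub_convolution_le_of_contDiff {u : Plane → ℝ} (hu : ContDiff ℝ ∞ u)
    (hku : ∀ x, Integrable (fun y => k y * (u (x - y) : ℂ)) volume)
    {c : ℝ} (hθ : 0 ≤ θ) (hc : 0 ≤ c) (hp : 1 ≤ p) {N : ℕ × ℕ → ℝ≥0∞}
    (hN : ∀ j ∈ antidiagonal n, ∀ h : Plane,
      eLpNorm (fun x => multiD j u (x - h) - multiD j u x) p volume ≤
        ENNReal.ofReal (c * ‖h‖ ^ θ) * N j)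
    (hk1 : ∫ x, k x = 1)
    (hmom : ∀ j₁ j₂ : ℕ, 1 ≤ j₁ + j₂ → j₁ + j₂ ≤ n →
      ∫ x : Plane, (x 0 ^ j₁ * x 1 ^ j₂) • k x = 0) :
    eLpNorm (fun x => (u x : ℂ) - ∫ y, k y * (u (x - y) : ℂ)) p volume ≤
      ENNReal.ofReal (c * (Real.Gamma (θ + 1) / Real.Gamma (n + θ + 1)) *
        ∫ x : Plane, ‖x‖ ^ (n + θ) * ‖k x‖) *
        ∑ j ∈ antidiagonal n, (n.choose j.1 : ℝ≥0∞) * N j := by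
  have remainder : (fun x => (u x : ℂ) - ∫ y, k y * (u (x - y) : ℂ)) =
      -fun x => ∫ y, k y * (taylorRem n u x (-y) : ℂ) := by
    funext x
    rw [Pi.neg_apply, integral_mul_taylorRem_neg hk hkα (by linarith) hk1 hmom (hku x), neg_sub]
  rw [remainder, eLpNorm_neg]
  exact eLpNorm_integral_mul_taylorRem_neg_le hk hkα hu hp (by positivity)
    (eLpNorm_taylorRem_le hu hp hθ hN)

end Kernel

theorem hasWeakDeriv_weakDeriv {j : ℕ × ℕ} {f : Plane → ℝ} (h : ∃ g, HasWeakDeriv j f g) :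
    HasWeakDeriv j f (weakDeriv j f) := by
  rw [weakDeriv, dif_pos h]
  exact h.choose_spec

theorem exists_hasWeakDeriv_of_besovSeminorm_ne_top {n : ℕ} {θ : ℝ} {p q : ℝ≥0∞}
    {f : Plane → ℝ} (hf : besovSeminorm n θ p q f ≠ ⊤) :
    ∀ j ∈ antidiagonal n, ∃ g, HasWeakDeriv j f g := by
  by_contra hcon
  exact hf (if_neg hcon)

theorem eLpNorm_le_of_forall_mollification {E F : Type*} [NormedAddCommGroup E] [NormedSpace ℝ E]
    [FiniteDimensional ℝ E] [HasContDiffBump E] [MeasurableSpace E] [BorelSpace E]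
    [NormedAddCommGroup F] [NormedSpace ℝ F] [CompleteSpace F] {μ : Measure E}
    [μ.IsAddHaarMeasure] {r : E → F} (hr : LocallyIntegrable r μ) {p B : ℝ≥0∞}
    (hB : ∀ ρ : E → ℝ, ContDiff ℝ ∞ ρ → HasCompactSupport ρ → (∀ x, 0 ≤ ρ x) → ∫ x, ρ x ∂μ = 1 →
      eLpNorm (ρ ⋆[ContinuousLinearMap.lsmul ℝ ℝ, μ] r) p μ ≤ B) :
    eLpNorm r p μ ≤ B := by
  let η (i : ℕ) : ContDiffBump (0 : E) :=
    ⟨1 / ((i : ℝ) + 1), 2 * (1 / ((i : ℝ) + 1)), by positivity,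
      lt_two_mul_self (by positivity)⟩
  have radius_tendsto : Tendsto (fun i => (η i).rOut) atTop (𝓝 0) := by
    simpa only [mul_zero] using (tendsto_one_div_add_atTop_nhds_zero_nat (𝕜 := ℝ)).const_mul 2
  have mollification_tendsto := ContDiffBump.ae_convolution_tendsto_right_of_locallyIntegrable
    (K := 2) radius_tendsto (Eventually.of_forall fun i => le_rfl) hr
  refine (Lp.eLpNorm_lim_le_liminf_eLpNorm (fun i => ?_) _ mollification_tendsto).trans ?_
  · exact ((η i).hasCompactSupport_normed.continuous_convolution_left
      (ContinuousLinearMap.lsmul ℝ ℝ) ((η i).contDiff_normed (n := 1)).continuous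
      hr).aestronglyMeasurable
  · refine (liminf_le_liminf (Eventually.of_forall fun i => ?_)).trans (liminf_const B).le
    exact hB _ (η i).contDiff_normed (η i).hasCompactSupport_normed (η i).nonneg_normed
      (η i).integral_normed

theorem ofReal_convolution (ρ f : Plane → ℝ) (x : Plane) :
    ((ρ ⋆[ContinuousLinearMap.lsmul ℝ ℝ] f) x : ℂ) =
      (ρ ⋆[ContinuousLinearMap.lsmul ℝ ℝ] fun x => (f x : ℂ)) x := by
  rw [convolution_lsmul, convolution_lsmul, ← integral_complex_ofReal]
  simp

section ConvolutionKernel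

variable {ρ : Plane → ℝ} {k : Plane → ℂ} (hρ : Continuous ρ) (hc : HasCompactSupport ρ)
  (hk : Integrable k volume)
include hρ hc hk

theorem convolution_integral_mul {f : Plane → ℂ} (hf : Integrable f volume) (x : Plane) :
    (ρ ⋆[ContinuousLinearMap.lsmul ℝ ℝ] fun x => ∫ y, k y * f (x - y)) x =
      ∫ y, k y * (ρ ⋆[ContinuousLinearMap.lsmul ℝ ℝ] f) (x - y) := by
  obtain ⟨C, hC⟩ := hρ.bounded_above_of_compact_support hc
  have kernel_integrable : Integrable (fun z : Plane × Plane => k z.2 * f (z.1 - z.2))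
      (volume.prod volume) :=
    hk.convolution_integrand (ContinuousLinearMap.mul ℝ ℂ) hf
  have integrable_prod : Integrable
      (fun z : Plane × Plane => ρ z.1 • (k z.2 * f (x - z.1 - z.2))) (volume.prod volume) :=
    Integrable.bdd_smul (((Measure.measurePreserving_sub_left volume x).prod
      (MeasurePreserving.id volume)).integrable_comp_of_integrable kernel_integrable) C
      (hρ.comp continuous_fst).aestronglyMeasurable (ae_of_all _ fun z => hC z.1)
  simp only [convolution_lsmul, ← integral_smul, ← integral_const_mul]
  rw [integral_integral_swap integrable_prod]
  simp only [mul_smul_comm, sub_right_comm]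

theorem convolution_sub_convolution {f : Plane → ℝ} (hf : Integrable f volume) :
    (ρ ⋆[ContinuousLinearMap.lsmul ℝ ℝ] fun x => (f x : ℂ) - ∫ y, k y * (f (x - y) : ℂ)) =
      fun x => ((ρ ⋆[ContinuousLinearMap.lsmul ℝ ℝ] f) x : ℂ) -
        ∫ y, k y * ((ρ ⋆[ContinuousLinearMap.lsmul ℝ ℝ] f) (x - y) : ℂ) := by
  funext x
  have exists_left (g : Plane → ℂ) (hg : Integrable g volume) :
      Integrable (fun t => ρ t • g (x - t)) volume :=
    hc.convolutionExists_left (ContinuousLinearMap.lsmul ℝ ℝ) hρ hg.locallyIntegrable x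
  have conv_integrable : Integrable (fun x => ∫ y, k y * (f (x - y) : ℂ)) volume :=
    hk.integrable_convolution (ContinuousLinearMap.mul ℝ ℂ) hf.ofReal
  simp only [ofReal_convolution]
  rw [← convolution_integral_mul hρ hc hk (f := fun x => (f x : ℂ)) hf.ofReal]
  simp only [convolution_lsmul, smul_sub]
  exact integral_sub (exists_left _ hf.ofReal) (exists_left _ conv_integrable)

end ConvolutionKernel

theorem integrable_mul_convolution {ρ f : Plane → ℝ} {k : Plane → ℂ} (hρ : Continuous ρ)
    (hc : HasCompactSupport ρ) (hk : Integrable k volume) (hf : Integrable f volume)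
    (x : Plane) :
    Integrable (fun y => k y * ((ρ ⋆[ContinuousLinearMap.lsmul ℝ ℝ] f) (x - y) : ℂ)) volume := by
  obtain ⟨C, hC⟩ := hρ.bounded_above_of_compact_support hc
  have mollification_continuous : Continuous (ρ ⋆[ContinuousLinearMap.lsmul ℝ ℝ] f) :=
    hc.continuous_convolution_left _ hρ hf.locallyIntegrable
  refine hk.mul_bdd (c := C * ∫ y, ‖f y‖)
    (Continuous.aestronglyMeasurable (by fun_prop)) (ae_of_all _ fun y => ?_)
  rw [Complex.norm_real, convolution_lsmul_swap, ← integral_const_mul]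
  refine norm_integral_le_of_norm_le (hf.norm.const_mul C) (ae_of_all _ fun z => ?_)
  rw [norm_smul]
  gcongr
  exact hC _

theorem eLpNorm_sub_convolution_le {f : Plane → ℝ} (hf : Integrable f volume)
    {k : Plane → ℂ} {n : ℕ} {θ : ℝ} (hθ : 0 < θ)
    {p q : ℝ≥0∞} (hp : 1 ≤ p) (hq : 1 ≤ q) (hfB : besovSeminorm n θ p q f ≠ ⊤)
    (hk : Integrable k volume) (hk1 : ∫ x, k x = 1)
    (hkα : Integrable (fun x : Plane => ‖x‖ ^ (n + θ) * ‖k x‖) volume)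
    (hmom : ∀ j₁ j₂ : ℕ, 1 ≤ j₁ + j₂ → j₁ + j₂ ≤ n →
      ∫ x : Plane, (x 0 ^ j₁ * x 1 ^ j₂) • k x = 0) :
    eLpNorm (fun x => (f x : ℂ) - ∫ y, k y * (f (x - y) : ℂ)) p volume ≤
      ENNReal.ofReal (cFrac θ q * (Real.Gamma (θ + 1) / Real.Gamma (n + θ + 1)) *
        ∫ x : Plane, ‖x‖ ^ (n + θ) * ‖k x‖) * besovSeminorm n θ p q f := by
  have weak_exists := exists_hasWeakDeriv_of_besovSeminorm_ne_top hfB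
  have error_integrable : Integrable (fun x => (f x : ℂ) - ∫ y, k y * (f (x - y) : ℂ)) volume :=
    hf.ofReal.sub (hk.integrable_convolution (ContinuousLinearMap.mul ℝ ℂ) hf.ofReal)
  rw [besovSeminorm, if_pos weak_exists]
  refine eLpNorm_le_of_forall_mollification error_integrable.locallyIntegrable
    fun ρ hρ hc hρ_nonneg hρ_one => ?_
  rw [convolution_sub_convolution hρ.continuous hc hk hf]
  refine eLpNorm_sub_convolution_le_of_contDiff hk hkα
    (hc.contDiff_convolution_left _ hρ hf.locallyIntegrable)
    (integrable_mul_convolution hρ.continuous hc hk hf) hθ.le (cFrac_nonneg hθ q) hp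
    (fun j hj h => ?_) hk1 hmom
  have hweak := hasWeakDeriv_weakDeriv (weak_exists j hj)
  rw [hweak.multiD_convolution hρ hc hf.locallyIntegrable]
  exact (eLpNorm_translate_sub_convolution_le hρ.continuous hc hρ_nonneg hρ_one hweak.1 hp
    h).trans (eLpNorm_translate_sub_le hθ p hq _ h)

end Approximation

section Rotation

/-- Orthonormal coordinates `(t, s)` on the plane, adapted to the direction `(cos φ, sin φ)`. -/
noncomputable def rotEquiv (φ : ℝ) : ℝ × ℝ ≃ᵐ Plane where
  toFun z := !₂[z.1 * Real.cos φ - z.2 * Real.sin φ, z.1 * Real.sin φ + z.2 * Real.cos φ]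
  invFun x := (x 0 * Real.cos φ + x 1 * Real.sin φ, -x 0 * Real.sin φ + x 1 * Real.cos φ)
  left_inv z := by
    have h := Real.sin_sq_add_cos_sq φ
    ext
    · simp only [Matrix.cons_val_zero, Matrix.cons_val_one]
      linear_combination z.1 * h
    · simp only [Matrix.cons_val_zero, Matrix.cons_val_one]
      linear_combination z.2 * h
  right_inv x := by
    have h := Real.sin_sq_add_cos_sq φ
    ext i
    fin_cases i
    · simp only [neg_mul, Fin.zero_eta, Matrix.cons_val_zero]
      linear_combination x 0 * h
    · simp only [neg_mul, Fin.mk_one, Matrix.cons_val_one, Matrix.cons_val_fin_one]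
      linear_combination x 1 * h
  measurable_toFun := by
    refine Continuous.measurable ?_
    change Continuous fun z : ℝ × ℝ =>
      !₂[z.1 * Real.cos φ - z.2 * Real.sin φ, z.1 * Real.sin φ + z.2 * Real.cos φ]
    fun_prop
  measurable_invFun := by
    refine Continuous.measurable ?_
    change Continuous fun x : Plane =>
      (x 0 * Real.cos φ + x 1 * Real.sin φ, -x 0 * Real.sin φ + x 1 * Real.cos φ)
    fun_prop

theorem rotEquiv_apply (φ : ℝ) (z : ℝ × ℝ) : rotEquiv φ z =
    !₂[z.1 * Real.cos φ - z.2 * Real.sin φ, z.1 * Real.sin φ + z.2 * Real.cos φ] := rfl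

theorem rotEquiv_symm_apply (φ : ℝ) (x : Plane) : (rotEquiv φ).symm x =
    (x 0 * Real.cos φ + x 1 * Real.sin φ, -x 0 * Real.sin φ + x 1 * Real.cos φ) := rfl

theorem measurePreserving_rotEquiv (φ : ℝ) : MeasurePreserving (rotEquiv φ) := by
  let M : Matrix (Fin 2) (Fin 2) ℝ := !![Real.cos φ, -Real.sin φ; Real.sin φ, Real.cos φ]
  have det_eq_one : M.det = 1 := by
    simp only [M, Matrix.det_fin_two_of]
    linear_combination Real.sin_sq_add_cos_sq φ
  have matrix_preserving :
      MeasurePreserving (Matrix.toLin' M) (volume : Measure (Fin 2 → ℝ)) volume := by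
    refine ⟨(LinearMap.continuous_of_finiteDimensional _).measurable, ?_⟩
    rw [Real.map_matrix_volume_pi_eq_smul_volume_pi (by rw [det_eq_one]; exact one_ne_zero),
      det_eq_one]
    simp
  have factorization : ⇑(rotEquiv φ) = (WithLp.toLp 2 ∘ ⇑(Matrix.toLin' M)) ∘
      ⇑(MeasurableEquiv.finTwoArrow (α := ℝ)).symm := by
    funext z
    rw [rotEquiv_apply]
    ext i
    fin_cases i
    · simp [M, sub_eq_add_neg]
    · simp [M]
  rw [factorization]
  exact ((PiLp.volume_preserving_toLp (Fin 2)).comp matrix_preserving).comp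
    ((volume_preserving_finTwoArrow ℝ).symm _)

theorem dist_rotEquiv (φ t s s' : ℝ) :
    dist (rotEquiv φ (t, s)) (rotEquiv φ (t, s')) = dist s s' := by
  rw [EuclideanSpace.dist_eq, Fin.sum_univ_two]
  simp only [Real.dist_eq, sq_abs]
  rw [← Real.sqrt_sq_eq_abs]
  congr 1
  simp only [rotEquiv_apply, Matrix.cons_val_zero, Matrix.cons_val_one]
  linear_combination (s - s') ^ 2 * Real.sin_sq_add_cos_sq φ

end Rotation

section Scaling

theorem lowPass_eq_mul_comp_div (W : ℝ → ℝ) {L : ℝ} (hL : 0 < L) :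
    lowPass W L = fun S => L * lowPass W 1 (S / L) := by
  funext S
  rw [lowPass, lowPass, abs_div, abs_of_pos hL, div_one, ← mul_assoc, mul_div_cancel₀ _ hL.ne']

theorem invFourier_const_mul_comp_div (A : ℝ → ℝ) (c : ℝ) {L : ℝ} (hL : 0 < L) (t : ℝ) :
    invFourier (fun S => c * A (S / L)) t = (c * L : ℝ) * invFourier A (L * t) := by
  have hLC : (L : ℂ) ≠ 0 := by exact_mod_cast hL.ne'
  have substitution := Measure.integral_comp_div
    (fun S : ℝ => (A S : ℂ) * Complex.exp (Complex.I * S * (L * t : ℝ))) L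
  have phase (S : ℝ) : Complex.I * ((S / L : ℝ) : ℂ) * ((L * t : ℝ) : ℂ) = Complex.I * S * t := by
    push_cast
    field_simp
  simp only [phase, abs_of_pos hL] at substitution
  simp only [invFourier, Complex.ofReal_mul c, mul_assoc (c : ℂ)]
  rw [integral_const_mul, substitution]
  simp only [Complex.real_smul]
  ring

theorem invFourier_lowPass_scale (W : ℝ → ℝ) {L : ℝ} (hL : 0 < L) (t : ℝ) :
    invFourier (lowPass W L) t = ((L ^ 2 : ℝ) : ℂ) * invFourier (lowPass W 1) (L * t) := by
  rw [lowPass_eq_mul_comp_div W hL, invFourier_const_mul_comp_div _ _ hL, sq]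

theorem convKernel_scale (W : ℝ → ℝ) {L : ℝ} (hL : 0 < L) (x : Plane) :
    convKernel W L x = ((L ^ 2 : ℝ) : ℂ) * convKernel W 1 (L • x) := by
  simp only [convKernel, backProj, invFourier_lowPass_scale W hL]
  rw [intervalIntegral.integral_const_mul]
  simp only [PiLp.smul_apply, smul_eq_mul, Complex.real_smul, mul_add, mul_assoc]
  ring

theorem integral_comp_scale {E : Type*} [NormedAddCommGroup E] [NormedSpace ℝ E] (F : Plane → E)
    {L : ℝ} (hL : 0 < L) : ∫ x, F (L • x) = (L ^ 2)⁻¹ • ∫ x, F x := by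
  rw [Measure.integral_comp_smul]
  simp [abs_of_pos hL]

theorem integrable_invFourier_lowPass {W : ℝ → ℝ} {L : ℝ} (hL : 0 < L)
    (h : Integrable (invFourier (lowPass W 1)) volume) :
    Integrable (invFourier (lowPass W L)) volume := by
  rw [funext (invFourier_lowPass_scale W hL)]
  exact (h.comp_mul_left' hL.ne').const_mul _

theorem integral_norm_invFourier_lowPass (W : ℝ → ℝ) {L : ℝ} (hL : 0 < L) :
    ∫ t, ‖invFourier (lowPass W L) t‖ = L * ∫ t, ‖invFourier (lowPass W 1) t‖ := by
  simp only [invFourier_lowPass_scale W hL, norm_mul, Complex.norm_real, norm_pow,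
    Real.norm_eq_abs, abs_of_pos hL]
  rw [integral_const_mul, Measure.integral_comp_mul_left (fun t => ‖invFourier (lowPass W 1) t‖) L,
    abs_of_pos (inv_pos.2 hL), smul_eq_mul]
  field_simp

theorem integrable_convKernel {W : ℝ → ℝ} {L : ℝ} (hL : 0 < L)
    (h : Integrable (convKernel W 1) volume) : Integrable (convKernel W L) volume := by
  rw [funext (convKernel_scale W hL)]
  exact (h.comp_smul hL.ne').const_mul _

theorem integral_convKernel_scale (W : ℝ → ℝ) {L : ℝ} (hL : 0 < L) :
    ∫ x, convKernel W L x = ∫ x, convKernel W 1 x := by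
  simp only [convKernel_scale W hL]
  rw [integral_const_mul, integral_comp_scale _ hL, Complex.real_smul, ← mul_assoc,
    ← Complex.ofReal_mul, mul_inv_cancel₀ (by positivity)]
  simp

theorem integral_monomial_convKernel_scale {W : ℝ → ℝ} {L : ℝ} (hL : 0 < L) {j₁ j₂ : ℕ}
    (h : ∫ x : Plane, (x 0 ^ j₁ * x 1 ^ j₂) • convKernel W 1 x = 0) :
    ∫ x : Plane, (x 0 ^ j₁ * x 1 ^ j₂) • convKernel W L x = 0 := by
  have scaled_moment : (fun x : Plane => (x 0 ^ j₁ * x 1 ^ j₂) • convKernel W L x) =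
      fun x => (L ^ 2 / L ^ (j₁ + j₂)) •
        (fun y : Plane => (y 0 ^ j₁ * y 1 ^ j₂) • convKernel W 1 y) (L • x) := by
    funext x
    rw [convKernel_scale W hL, ← Complex.real_smul]
    simp only [smul_smul, PiLp.smul_apply, smul_eq_mul]
    congr 1
    rw [mul_pow, mul_pow, pow_add]
    field_simp
  rw [scaled_moment, integral_smul, integral_comp_scale
    (fun y : Plane => (y 0 ^ j₁ * y 1 ^ j₂) • convKernel W 1 y) hL, h]
  simp

theorem rpow_norm_mul_convKernel (W : ℝ → ℝ) {L : ℝ} (hL : 0 < L) (α : ℝ) (x : Plane) :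
    ‖x‖ ^ α * ‖convKernel W L x‖ =
      L ^ 2 * L ^ (-α) * (‖L • x‖ ^ α * ‖convKernel W 1 (L • x)‖) := by
  rw [convKernel_scale W hL, norm_mul, Complex.norm_real, norm_smul, Real.norm_eq_abs,
    Real.norm_eq_abs, abs_of_pos hL, abs_of_pos (by positivity), Real.mul_rpow hL.le
    (norm_nonneg _), Real.rpow_neg hL.le]
  field_simp [(Real.rpow_pos_of_pos hL α).ne']

theorem integrable_rpow_norm_mul_convKernel {W : ℝ → ℝ} {L : ℝ} (hL : 0 < L) {α : ℝ}
    (h : Integrable (fun x : Plane => ‖x‖ ^ α * ‖convKernel W 1 x‖) volume) :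
    Integrable (fun x : Plane => ‖x‖ ^ α * ‖convKernel W L x‖) volume := by
  simp only [rpow_norm_mul_convKernel W hL α]
  exact (h.comp_smul hL.ne').const_mul _

theorem integral_rpow_norm_mul_convKernel (W : ℝ → ℝ) {L : ℝ} (hL : 0 < L) (α : ℝ) :
    ∫ x : Plane, ‖x‖ ^ α * ‖convKernel W L x‖ =
      L ^ (-α) * ∫ x : Plane, ‖x‖ ^ α * ‖convKernel W 1 x‖ := by
  simp only [rpow_norm_mul_convKernel W hL α]
  rw [integral_const_mul, integral_comp_scale (fun x => ‖x‖ ^ α * ‖convKernel W 1 x‖) hL,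
    smul_eq_mul]
  field_simp

end Scaling

section KernelMass

open scoped FourierTransform RealInnerProductSpace

/-- The contribution of the positive frequencies to the inverse Fourier transform of the filter,
without the factor `1 / (2π)`. -/
noncomputable def halfFourier (W : ℝ → ℝ) (τ : ℝ) : ℂ :=
  ∫ r in Set.Ioi (0 : ℝ), (lowPass W 1 r : ℂ) * Complex.exp (Complex.I * r * τ)

theorem norm_exp_I_mul (a b : ℝ) : ‖Complex.exp (Complex.I * a * b)‖ = 1 := by
  rw [mul_assoc, ← Complex.ofReal_mul, mul_comm]
  exact Complex.norm_exp_ofReal_mul_I _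

theorem integrable_mul_exp {A : ℝ → ℝ} (hA : Integrable A) (τ : ℝ) :
    Integrable fun S : ℝ => (A S : ℂ) * Complex.exp (Complex.I * S * τ) := by
  refine hA.ofReal.mul_bdd (c := 1) ?_ (ae_of_all _ fun S => (norm_exp_I_mul S τ).le)
  exact Continuous.aestronglyMeasurable (by fun_prop)

theorem continuous_integral_mul_exp {A : ℝ → ℝ} {μ : Measure ℝ} (hA : Integrable A μ) :
    Continuous fun τ : ℝ => ∫ S, (A S : ℂ) * Complex.exp (Complex.I * S * τ) ∂μ := by
  refine continuous_of_dominated (bound := fun S => ‖A S‖) (fun τ => ?_)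
    (fun τ => ae_of_all _ fun S => ?_) hA.norm (ae_of_all _ fun S => by fun_prop)
  · exact hA.ofReal.aestronglyMeasurable.mul (Continuous.aestronglyMeasurable (by fun_prop))
  · rw [norm_mul, norm_exp_I_mul, mul_one, Complex.norm_real]

theorem lowPass_neg {W : ℝ → ℝ} (hWeven : Function.Even W) (L S : ℝ) :
    lowPass W L (-S) = lowPass W L S := by
  rw [lowPass, lowPass, abs_neg, neg_div, hWeven]

theorem integral_lowPass_mul_exp {W : ℝ → ℝ} (hWeven : Function.Even W)
    (hA : Integrable (lowPass W 1)) (τ : ℝ) :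
    ∫ S : ℝ, (lowPass W 1 S : ℂ) * Complex.exp (Complex.I * S * τ) =
      halfFourier W τ + halfFourier W (-τ) := by
  have integrable := integrable_mul_exp hA τ
  have reflection := integral_comp_neg_Ioi (0 : ℝ)
    (fun S : ℝ => (lowPass W 1 S : ℂ) * Complex.exp (Complex.I * S * τ))
  rw [neg_zero] at reflection
  rw [← intervalIntegral.integral_Iic_add_Ioi (b := 0) integrable.integrableOn
    integrable.integrableOn, ← reflection, add_comm]
  simp only [halfFourier, lowPass_neg hWeven, Complex.ofReal_neg, mul_neg, neg_mul]

theorem integral_halfFourier_neg (W : ℝ → ℝ) (x : Plane) :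
    ∫ φ in (0 : ℝ)..Real.pi, halfFourier W (-(x 0 * Real.cos φ + x 1 * Real.sin φ)) =
      ∫ φ in (-Real.pi)..0, halfFourier W (x 0 * Real.cos φ + x 1 * Real.sin φ) := by
  have half_turn := intervalIntegral.integral_comp_sub_right (a := 0) (b := Real.pi)
    (fun φ : ℝ => halfFourier W (x 0 * Real.cos φ + x 1 * Real.sin φ)) Real.pi
  rw [zero_sub, sub_self] at half_turn
  rw [← half_turn]
  simp only [Real.cos_sub_pi, Real.sin_sub_pi, mul_neg, neg_add]

theorem convKernel_eq_integral_halfFourier {W : ℝ → ℝ} (hWeven : Function.Even W)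
    (hA : Integrable (lowPass W 1)) (x : Plane) :
    convKernel W 1 x = ((1 / (4 * Real.pi ^ 2) : ℝ) : ℂ) * ∫ φ in (-Real.pi)..Real.pi,
      halfFourier W (x 0 * Real.cos φ + x 1 * Real.sin φ) := by
  have continuous_halfFourier : Continuous (halfFourier W) :=
    continuous_integral_mul_exp hA.restrict
  have intervalIntegrable (a b : ℝ) : IntervalIntegrable
      (fun φ : ℝ => halfFourier W (x 0 * Real.cos φ + x 1 * Real.sin φ)) volume a b :=
    Continuous.intervalIntegrable (by fun_prop) _ _
  simp only [convKernel, backProj, invFourier, integral_lowPass_mul_exp hWeven hA]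
  rw [intervalIntegral.integral_smul, intervalIntegral.integral_add (intervalIntegrable _ _)
    (Continuous.intervalIntegrable (by fun_prop) _ _), integral_halfFourier_neg, add_comm,
    intervalIntegral.integral_add_adjacent_intervals (intervalIntegrable _ _)
      (intervalIntegrable _ _)]
  simp only [Complex.real_smul]
  push_cast
  field_simp
  ring

theorem norm_rotEquiv_polarCoord_symm {z : ℝ × ℝ} (hz : 0 ≤ z.1) :
    ‖rotEquiv 0 (polarCoord.symm z)‖ = z.1 := by
  rw [EuclideanSpace.norm_eq, Real.sqrt_eq_iff_eq_sq (by positivity) hz]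
  simp only [polarCoord_symm_apply, rotEquiv_apply, Real.cos_zero, mul_one, Real.sin_zero,
    mul_zero, sub_zero, zero_add, Real.norm_eq_abs, sq_abs, Fin.sum_univ_two,
    Matrix.cons_val_zero, Matrix.cons_val_one]
  linear_combination z.1 ^ 2 * Real.sin_sq_add_cos_sq z.2

theorem inner_rotEquiv_polarCoord_symm (z : ℝ × ℝ) (x : Plane) :
    ⟪rotEquiv 0 (polarCoord.symm z), x⟫ = z.1 * (x 0 * Real.cos z.2 + x 1 * Real.sin z.2) := by
  simp only [polarCoord_symm_apply, rotEquiv_apply, Real.cos_zero, mul_one, Real.sin_zero,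
    mul_zero, sub_zero, zero_add, PiLp.inner_apply, RCLike.inner_apply, Real.ringHom_apply,
    Fin.sum_univ_two, Matrix.cons_val_zero, Matrix.cons_val_one]
  ring

theorem integral_radial_mul_exp {W : ℝ → ℝ} (hA : Integrable (lowPass W 1)) (x : Plane) :
    ∫ ξ : Plane, (W ‖ξ‖ : ℂ) * Complex.exp (Complex.I * ⟪ξ, x⟫) =
      ∫ φ in (-Real.pi)..Real.pi, halfFourier W (x 0 * Real.cos φ + x 1 * Real.sin φ) := by
  rw [← (measurePreserving_rotEquiv 0).integral_comp (rotEquiv 0).measurableEmbedding,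
    ← integral_comp_polarCoord_symm, polarCoord_target,
    intervalIntegral.integral_of_le (by linarith [Real.pi_pos]), ← restrict_Ioo_eq_restrict_Ioc]
  -- The Jacobian `r` of polar coordinates is exactly the factor `|S|` of the filter.
  have polar_integrand : ∀ z ∈ Set.Ioi (0 : ℝ) ×ˢ Set.Ioo (-Real.pi) Real.pi,
      z.1 • ((W ‖rotEquiv 0 (polarCoord.symm z)‖ : ℂ) *
        Complex.exp (Complex.I * ⟪rotEquiv 0 (polarCoord.symm z), x⟫)) =
      (lowPass W 1 z.1 : ℂ) * Complex.exp (Complex.I * z.1 *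
        ((x 0 * Real.cos z.2 + x 1 * Real.sin z.2 : ℝ) : ℂ)) := by
    intro z hz
    have radius_pos : 0 < z.1 := hz.1
    rw [norm_rotEquiv_polarCoord_symm radius_pos.le, inner_rotEquiv_polarCoord_symm, lowPass,
      abs_of_pos radius_pos, div_one, Complex.real_smul]
    push_cast
    ring_nf
  rw [setIntegral_congr_fun (measurableSet_Ioi.prod measurableSet_Ioo) polar_integrand,
    Measure.volume_eq_prod, ← Measure.prod_restrict, integral_prod_symm]
  · rfl
  · have integrable_radius : Integrable (fun z : ℝ × ℝ => (lowPass W 1 z.1 : ℂ))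
        ((volume.restrict (Set.Ioi 0)).prod (volume.restrict (Set.Ioo (-Real.pi) Real.pi))) :=
      (hA.restrict.ofReal (𝕜 := ℂ)).comp_fst _
    refine integrable_radius.mul_bdd (c := 1) ?_ (ae_of_all _ fun z => (norm_exp_I_mul _ _).le)
    exact Continuous.aestronglyMeasurable (by fun_prop)

theorem integrable_radial {W : ℝ → ℝ} (hA : Integrable (lowPass W 1)) :
    Integrable fun ξ : Plane => (W ‖ξ‖ : ℂ) := by
  refine Integrable.ofReal (f := fun ξ : Plane => W ‖ξ‖)
    ((integrable_fun_norm_addHaar (volume : Measure Plane)).2 ?_)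
  refine (hA.integrableOn (s := Set.Ioi 0)).congr_fun (fun r (hr : 0 < r) => ?_) measurableSet_Ioi
  simp [lowPass, abs_of_pos hr]

theorem fourier_radial_eq_convKernel {W : ℝ → ℝ} (hWeven : Function.Even W)
    (hA : Integrable (lowPass W 1)) (x : Plane) :
    𝓕 (fun ξ : Plane => (W ‖ξ‖ : ℂ)) x =
      ((4 * Real.pi ^ 2 : ℝ) : ℂ) * convKernel W 1 ((-(2 * Real.pi)) • x) := by
  rw [convKernel_eq_integral_halfFourier hWeven hA, ← integral_radial_mul_exp hA, ← mul_assoc,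
    ← Complex.ofReal_mul, mul_one_div_cancel (by positivity), Complex.ofReal_one, one_mul,
    Real.fourier_eq']
  congr 1; funext ξ
  rw [smul_eq_mul, mul_comm, inner_smul_right]
  congr 2
  push_cast
  ring

/-- Fourier inversion at the origin: the kernel is the inverse Fourier transform of `W ‖·‖`. -/
theorem integral_convKernel {W : ℝ → ℝ} (hWeven : Function.Even W)
    (hW0 : W 0 = 1) (hWc : ContinuousAt W 0) (hA : Integrable (lowPass W 1))
    (hK : Integrable (convKernel W 1)) : ∫ x, convKernel W 1 x = 1 := by
  have scale_ne_zero : -(2 * Real.pi) ≠ 0 := neg_ne_zero.2 (by positivity)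
  have fourier_eq : 𝓕 (fun ξ : Plane => (W ‖ξ‖ : ℂ)) =
      fun x => ((4 * Real.pi ^ 2 : ℝ) : ℂ) * convKernel W 1 ((-(2 * Real.pi)) • x) :=
    funext (fourier_radial_eq_convKernel hWeven hA)
  have integrable_fourier : Integrable (𝓕 (fun ξ : Plane => (W ‖ξ‖ : ℂ))) := by
    rw [fourier_eq]
    exact (hK.comp_smul scale_ne_zero).const_mul _
  have continuousAt_zero : ContinuousAt (fun ξ : Plane => (W ‖ξ‖ : ℂ)) 0 := by
    refine Complex.continuous_ofReal.continuousAt.comp (ContinuousAt.comp (g := W) ?_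
      continuous_norm.continuousAt)
    rwa [norm_zero]
  have inversion := (integrable_radial hA).fourierInv_fourier_eq integrable_fourier
    continuousAt_zero
  rw [Real.fourierInv_eq', fourier_eq] at inversion
  simp only [inner_zero_right, mul_zero, Complex.ofReal_zero, zero_mul, Complex.exp_zero,
    one_smul, norm_zero, hW0, Complex.ofReal_one] at inversion
  rw [integral_const_mul, Measure.integral_comp_smul, Complex.real_smul, ← mul_assoc,
    ← Complex.ofReal_mul] at inversion
  have jacobian : 4 * Real.pi ^ 2 * |((-(2 * Real.pi)) ^ Module.finrank ℝ Plane)⁻¹| = 1 := by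
    rw [finrank_euclideanSpace_fin, neg_sq, abs_of_pos (by positivity)]
    field_simp
    norm_num
  rwa [jacobian, Complex.ofReal_one, one_mul] at inversion

end KernelMass

section ExactData

theorem continuous_invFourier_lowPass {W : ℝ → ℝ} (hA : Integrable (lowPass W 1)) {L : ℝ}
    (hL : 0 < L) : Continuous (invFourier (lowPass W L)) := by
  have continuous_unit : Continuous (invFourier (lowPass W 1)) :=
    (continuous_integral_mul_exp hA).const_smul (1 / (2 * Real.pi) : ℝ)
  rw [funext (invFourier_lowPass_scale W hL)]
  fun_prop

theorem exists_norm_invFourier_le (A : ℝ → ℝ) : ∃ C, ∀ t, ‖invFourier A t‖ ≤ C := by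
  refine ⟨‖(1 / (2 * Real.pi) : ℝ)‖ * ∫ S, ‖A S‖, fun t => ?_⟩
  rw [invFourier, norm_smul]
  gcongr
  refine (norm_integral_le_integral_norm _).trans_eq ?_
  simp only [norm_mul, norm_exp_I_mul, mul_one, Complex.norm_real]

variable {f : Plane → ℝ} {a : ℝ → ℂ} {C : ℝ}

theorem integrable_comp_rotEquiv (hf : Integrable f) (φ : ℝ) :
    Integrable fun z : ℝ × ℝ => f (rotEquiv φ z) :=
  ((measurePreserving_rotEquiv φ).integrable_comp_emb (rotEquiv φ).measurableEmbedding).2 hf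

theorem integral_mul_radon (hf : Integrable f) (ha : Continuous a)
    (haC : ∀ t, ‖a t‖ ≤ C) (t φ : ℝ) :
    ∫ s, a s * (radon f (t - s, φ) : ℂ) =
      ∫ y : Plane, a (t - (y 0 * Real.cos φ + y 1 * Real.sin φ)) * (f y : ℂ) := by
  have reflection := integral_sub_left_eq_self (fun s => a s * (radon f (t - s, φ) : ℂ)) volume t
  have line_coordinate (z : ℝ × ℝ) :
      rotEquiv φ z 0 * Real.cos φ + rotEquiv φ z 1 * Real.sin φ = z.1 :=
    congrArg Prod.fst ((rotEquiv φ).symm_apply_apply z)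
  simp only [sub_sub_cancel] at reflection
  rw [← reflection, ← (measurePreserving_rotEquiv φ).integral_comp (rotEquiv φ).measurableEmbedding]
  simp only [line_coordinate]
  rw [Measure.volume_eq_prod, integral_prod]
  · simp only [integral_const_mul, integral_complex_ofReal]
    rfl
  · refine (integrable_comp_rotEquiv hf φ).ofReal.bdd_mul (c := C) ?_ (ae_of_all _ fun z => haC _)
    exact Continuous.aestronglyMeasurable (by fun_prop)

theorem integrable_mul_radon (hf : Integrable f) (ha : Continuous a)
    (haC : ∀ t, ‖a t‖ ≤ C) (t φ : ℝ) :
    Integrable fun s => a s * (radon f (t - s, φ) : ℂ) := by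
  have integrable_radon : Integrable fun s => radon f (s, φ) :=
    (integrable_comp_rotEquiv hf φ).integral_prod_left
  exact (integrable_radon.comp_sub_left t).ofReal.bdd_mul ha.aestronglyMeasurable
    (ae_of_all _ haC)

theorem integrable_comp_sub_mul (hf : Integrable f) (ha : Continuous a)
    (haC : ∀ t, ‖a t‖ ≤ C) {μ : Measure ℝ} [IsFiniteMeasure μ] (x : Plane) :
    Integrable (fun z : ℝ × Plane => a (x 0 * Real.cos z.1 + x 1 * Real.sin z.1 -
      (z.2 0 * Real.cos z.1 + z.2 1 * Real.sin z.1)) * (f z.2 : ℂ)) (μ.prod volume) := by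
  refine Integrable.bdd_mul (c := C) (g := fun z : ℝ × Plane => (f z.2 : ℂ))
    ((hf.ofReal (𝕜 := ℂ)).comp_snd _) ?_ (ae_of_all _ fun z => haC _)
  exact Continuous.aestronglyMeasurable (by fun_prop)

theorem intervalIntegrable_filtered_radon {W : ℝ → ℝ} {L : ℝ} (hf : Integrable f)
    (ha : Continuous (invFourier (lowPass W L))) (x : Plane) :
    IntervalIntegrable (fun φ => filtered W L (radon f)
      (x 0 * Real.cos φ + x 1 * Real.sin φ, φ)) volume 0 Real.pi := by
  obtain ⟨C, haC⟩ := exists_norm_invFourier_le (lowPass W L)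
  rw [intervalIntegrable_iff_integrableOn_Ioc_of_le Real.pi_pos.le]
  simp only [filtered, integral_mul_radon hf ha haC]
  exact (integrable_comp_sub_mul hf ha haC x).integral_prod_left

theorem reconstruction_radon {W : ℝ → ℝ} {L : ℝ} (hf : Integrable f)
    (ha : Continuous (invFourier (lowPass W L))) (x : Plane) :
    reconstruction W L (radon f) x = ∫ y, convKernel W L y * (f (x - y) : ℂ) := by
  obtain ⟨C, haC⟩ := exists_norm_invFourier_le (lowPass W L)
  have reflection :=
    integral_sub_left_eq_self (fun y => convKernel W L y * (f (x - y) : ℂ)) volume x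
  simp only [sub_sub_cancel] at reflection
  rw [← reflection]
  simp only [reconstruction, backProj, filtered, integral_mul_radon hf ha haC]
  rw [intervalIntegral.integral_of_le Real.pi_pos.le,
    integral_integral_swap (integrable_comp_sub_mul hf ha haC x), ← integral_smul,
    ← integral_smul]
  congr 1; funext y
  rw [convKernel, backProj, integral_mul_const, intervalIntegral.integral_of_le Real.pi_pos.le,
    smul_mul_assoc, smul_mul_assoc]
  simp only [PiLp.sub_apply]
  congr 4
  funext φ
  congr 1; ring

end ExactData

section Measurability

/-- Lebesgue measure on the angles `[0, π)`. -/
noncomputable def angleMeasure : Measure ℝ := volume.restrict (Set.Ico 0 Real.pi)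

instance : IsFiniteMeasure angleMeasure := by
  unfold angleMeasure; infer_instance

theorem angleMeasure_univ : angleMeasure Set.univ = ENNReal.ofReal Real.pi := by
  simp [angleMeasure]

theorem sinoMeasure_eq_prod : sinoMeasure = (volume : Measure ℝ).prod angleMeasure := by
  rw [sinoMeasure, angleMeasure, Measure.volume_eq_prod, ← Measure.prod_restrict,
    Measure.restrict_univ]

instance : SFinite sinoMeasure := by
  rw [sinoMeasure_eq_prod]; infer_instance

/-- The point of the sinogram that encodes the line through a point of the plane with normal
direction `φ`; back projection averages over these. -/
noncomputable def sinoPoint (z : Plane × ℝ) : ℝ × ℝ :=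
  (z.1 0 * Real.cos z.2 + z.1 1 * Real.sin z.2, z.2)

theorem continuous_sinoPoint : Continuous sinoPoint := by
  unfold sinoPoint; fun_prop

theorem measurePreserving_rotEquiv_symm_skew (μ : Measure ℝ) [SFinite μ] :
    MeasurePreserving (fun z : ℝ × Plane => (z.1, (rotEquiv z.1).symm z.2))
      (μ.prod volume) (μ.prod volume) := by
  refine (MeasurePreserving.id μ).skew_product (g := fun φ x => (rotEquiv φ).symm x) ?_
    (ae_of_all _ fun φ => ((measurePreserving_rotEquiv φ).symm _).map_eq)
  refine Continuous.measurable ?_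
  simp only [Function.uncurry_def, rotEquiv_symm_apply]
  fun_prop

theorem quasiMeasurePreserving_sinoPoint :
    Measure.QuasiMeasurePreserving sinoPoint (volume.prod angleMeasure) sinoMeasure := by
  have forget_line_parameter :
      Measure.QuasiMeasurePreserving (Prod.map id Prod.fst : ℝ × (ℝ × ℝ) → ℝ × ℝ)
        (angleMeasure.prod (volume.prod volume)) (angleMeasure.prod volume) :=
    QuasiMeasurePreserving.prodMap (Measure.QuasiMeasurePreserving.id _)
      Measure.quasiMeasurePreserving_fst
  have swap {X Y : Type} [MeasurableSpace X] [MeasurableSpace Y] (μ : Measure X) (ν : Measure Y)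
      [SFinite μ] [SFinite ν] :
      Measure.QuasiMeasurePreserving Prod.swap (μ.prod ν) (ν.prod μ) :=
    Measure.measurePreserving_swap.quasiMeasurePreserving
  rw [sinoMeasure_eq_prod]
  exact (swap _ _).comp (forget_line_parameter.comp
    ((measurePreserving_rotEquiv_symm_skew angleMeasure).quasiMeasurePreserving.comp (swap _ _)))

theorem measurePreserving_sinoMeasure_sub_right (s : ℝ) :
    MeasurePreserving (fun z : ℝ × ℝ => (z.1 - s, z.2)) sinoMeasure sinoMeasure := by
  rw [sinoMeasure_eq_prod]
  exact (measurePreserving_sub_right volume s).prod (MeasurePreserving.id angleMeasure)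

theorem quasiMeasurePreserving_sinoShift :
    Measure.QuasiMeasurePreserving (fun z : (ℝ × ℝ) × ℝ => (z.1.1 - z.2, z.1.2))
      (sinoMeasure.prod volume) sinoMeasure :=
  QuasiMeasurePreserving.prod_of_left (by fun_prop) (ae_of_all _ fun s =>
    (measurePreserving_sinoMeasure_sub_right s).quasiMeasurePreserving)

theorem aestronglyMeasurable_radon {f : Plane → ℝ} (hf : AEStronglyMeasurable f) :
    AEStronglyMeasurable (radon f) sinoMeasure := by
  have line_point : Measure.QuasiMeasurePreserving (fun z : ℝ × (ℝ × ℝ) => rotEquiv z.1 z.2)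
      (angleMeasure.prod (volume.prod volume)) volume := by
    refine QuasiMeasurePreserving.prod_of_right ?_
      (ae_of_all _ fun φ => (measurePreserving_rotEquiv φ).quasiMeasurePreserving)
    refine Continuous.measurable ?_
    simp only [rotEquiv_apply]
    fun_prop
  have reorder : MeasurePreserving (fun z : (ℝ × ℝ) × ℝ => (z.1.2, (z.1.1, z.2)))
      ((volume.prod angleMeasure).prod volume) (angleMeasure.prod (volume.prod volume)) :=
    (measurePreserving_prodAssoc angleMeasure volume volume).comp
      (Measure.measurePreserving_swap.prod (MeasurePreserving.id volume))
  have integrand := hf.comp_quasiMeasurePreserving (line_point.comp reorder.quasiMeasurePreserving)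
  rw [sinoMeasure_eq_prod]
  exact integrand.integral_prod_right'

variable {a : ℝ → ℂ} {g : ℝ × ℝ → ℝ} {W : ℝ → ℝ} {L : ℝ}

theorem aestronglyMeasurable_filtered_integrand (ha : Continuous a)
    (hg : AEStronglyMeasurable g sinoMeasure) :
    AEStronglyMeasurable (fun z : (ℝ × ℝ) × ℝ => a z.2 * (g (z.1.1 - z.2, z.1.2) : ℂ))
      (sinoMeasure.prod volume) :=
  (ha.comp continuous_snd).aestronglyMeasurable.mul
    (Complex.continuous_ofReal.comp_aestronglyMeasurable
      (hg.comp_quasiMeasurePreserving quasiMeasurePreserving_sinoShift))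

theorem aestronglyMeasurable_filtered_sinoPoint
    (ha : Continuous (invFourier (lowPass W L))) (hg : AEStronglyMeasurable g sinoMeasure) :
    AEStronglyMeasurable (fun z => filtered W L g (sinoPoint z)) (volume.prod angleMeasure) :=
  (aestronglyMeasurable_filtered_integrand ha
    hg).integral_prod_right'.comp_quasiMeasurePreserving quasiMeasurePreserving_sinoPoint

theorem backProj_eq_integral_sinoPoint (h : ℝ × ℝ → ℂ) (x : Plane) :
    backProj h x = (1 / Real.pi : ℝ) • ∫ φ, h (sinoPoint (x, φ)) ∂angleMeasure := by
  rw [backProj, intervalIntegral.integral_of_le Real.pi_pos.le, angleMeasure,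
    integral_Ico_eq_integral_Ioc]
  rfl

theorem aestronglyMeasurable_reconstruction
    (ha : Continuous (invFourier (lowPass W L))) (hg : AEStronglyMeasurable g sinoMeasure) :
    AEStronglyMeasurable (reconstruction W L g) := by
  unfold reconstruction
  simp only [backProj_eq_integral_sinoPoint]
  exact ((aestronglyMeasurable_filtered_sinoPoint ha
    hg).integral_prod_right'.const_smul (1 / Real.pi : ℝ)).const_smul (1 / 2 : ℝ)

end Measurability

section DataError

theorem volume_slice_le_diam {Ω : Set Plane} (hΩ : Bornology.IsBounded Ω) (φ t : ℝ) :
    volume {s : ℝ | rotEquiv φ (t, s) ∈ Ω} ≤ ENNReal.ofReal (Metric.diam Ω) := by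
  refine (Real.volume_le_diam _).trans (Metric.ediam_le_of_forall_dist_le fun s hs s' hs' => ?_)
  rw [← dist_rotEquiv φ t]
  exact Metric.dist_le_diam_of_mem hΩ hs hs'

theorem setLIntegral_ridge_le_of_measurableSet {Ω : Set Plane} (hΩ : Bornology.IsBounded Ω)
    (hΩm : MeasurableSet Ω) {Q : ℝ → ℝ≥0∞} (hQ : Measurable Q) (φ : ℝ) :
    ∫⁻ x in Ω, Q (x 0 * Real.cos φ + x 1 * Real.sin φ) ≤
      ENNReal.ofReal (Metric.diam Ω) * ∫⁻ t, Q t := by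
  have line_coordinate (z : ℝ × ℝ) :
      rotEquiv φ z 0 * Real.cos φ + rotEquiv φ z 1 * Real.sin φ = z.1 :=
    congrArg Prod.fst ((rotEquiv φ).symm_apply_apply z)
  have measurableSet_preimage : MeasurableSet (rotEquiv φ ⁻¹' Ω) := (rotEquiv φ).measurable hΩm
  have measurable_indicator :
      Measurable ((rotEquiv φ ⁻¹' Ω).indicator fun z : ℝ × ℝ => Q z.1) :=
    (hQ.comp measurable_fst).indicator measurableSet_preimage
  rw [← (measurePreserving_rotEquiv φ).setLIntegral_comp_preimage_emb
    (rotEquiv φ).measurableEmbedding]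
  simp only [line_coordinate]
  rw [← lintegral_indicator measurableSet_preimage, Measure.volume_eq_prod,
    lintegral_prod _ measurable_indicator.aemeasurable, mul_comm, ← lintegral_mul_const _ hQ]
  refine lintegral_mono fun t => ?_
  calc ∫⁻ s, (rotEquiv φ ⁻¹' Ω).indicator (fun z => Q z.1) (t, s)
      = ∫⁻ s, {s : ℝ | rotEquiv φ (t, s) ∈ Ω}.indicator (fun _ => Q t) s := rfl
    _ = Q t * volume {s : ℝ | rotEquiv φ (t, s) ∈ Ω} :=
        lintegral_indicator_const (measurable_prodMk_left measurableSet_preimage) _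
    _ ≤ Q t * ENNReal.ofReal (Metric.diam Ω) := by gcongr; exact volume_slice_le_diam hΩ φ t

theorem setLIntegral_ridge_le {Ω : Set Plane} (hΩ : Bornology.IsBounded Ω) {Q : ℝ → ℝ≥0∞}
    (hQ : Measurable Q) (φ : ℝ) :
    ∫⁻ x in Ω, Q (x 0 * Real.cos φ + x 1 * Real.sin φ) ≤
      ENNReal.ofReal (Metric.diam Ω) * ∫⁻ t, Q t := by
  rw [← Metric.diam_closure]
  exact (lintegral_mono_set subset_closure).trans
    (setLIntegral_ridge_le_of_measurableSet hΩ.closure isClosed_closure.measurableSet hQ φ)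

theorem eLpNormEssSup_lintegral_sinoPoint_le (H : ℝ × ℝ → ℝ≥0∞) :
    eLpNormEssSup (fun x => ∫⁻ φ, H (sinoPoint (x, φ)) ∂angleMeasure) volume ≤
      ENNReal.ofReal Real.pi * eLpNormEssSup H sinoMeasure := by
  refine eLpNormEssSup_le_of_ae_enorm_bound ?_
  filter_upwards [Measure.ae_ae_of_ae_prod (quasiMeasurePreserving_sinoPoint.ae
    (ae_le_eLpNormEssSup (f := H)))] with x hx
  calc ‖∫⁻ φ, H (sinoPoint (x, φ)) ∂angleMeasure‖ₑ
      ≤ ∫⁻ _, eLpNormEssSup H sinoMeasure ∂angleMeasure := lintegral_mono_ae hx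
    _ = ENNReal.ofReal Real.pi * eLpNormEssSup H sinoMeasure := by
        rw [lintegral_const, angleMeasure_univ, mul_comm]

theorem setLIntegral_lintegral_sinoPoint_rpow_le {Ω : Set Plane} (hΩ : Bornology.IsBounded Ω)
    {r : ℝ} (hr : 1 ≤ r) {H : ℝ × ℝ → ℝ≥0∞} (hH : Measurable H) :
    ∫⁻ x in Ω, (∫⁻ φ, H (sinoPoint (x, φ)) ∂angleMeasure) ^ r ≤
      ENNReal.ofReal (Real.pi ^ (r - 1) * Metric.diam Ω) * ∫⁻ z, H z ^ r ∂sinoMeasure := by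
  have measurable_comp : Measurable fun z : Plane × ℝ => H (sinoPoint z) :=
    hH.comp continuous_sinoPoint.measurable
  have exponent_nonneg : 0 ≤ r - 1 := sub_nonneg.2 hr
  calc ∫⁻ x in Ω, (∫⁻ φ, H (sinoPoint (x, φ)) ∂angleMeasure) ^ r
      ≤ ∫⁻ x in Ω, ENNReal.ofReal Real.pi ^ (r - 1) *
          ∫⁻ φ, H (sinoPoint (x, φ)) ^ r ∂angleMeasure := by
        refine lintegral_mono fun x => ?_
        rw [← angleMeasure_univ]
        exact lintegral_rpow_le_measure_univ_rpow_mul hr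
          (measurable_comp.comp measurable_prodMk_left).aemeasurable
    _ = ENNReal.ofReal Real.pi ^ (r - 1) *
          ∫⁻ φ, (∫⁻ x in Ω, H (sinoPoint (x, φ)) ^ r) ∂angleMeasure := by
        rw [lintegral_const_mul' _ _ (ENNReal.rpow_ne_top_of_nonneg exponent_nonneg
          ENNReal.ofReal_ne_top), lintegral_lintegral_swap]
        exact (measurable_comp.pow_const r).aemeasurable
    _ ≤ ENNReal.ofReal Real.pi ^ (r - 1) *
          ∫⁻ φ, ENNReal.ofReal (Metric.diam Ω) * (∫⁻ t, H (t, φ) ^ r) ∂angleMeasure := by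
        gcongr with φ
        exact setLIntegral_ridge_le hΩ (Q := fun t => H (t, φ) ^ r)
          ((hH.comp measurable_prodMk_right).pow_const r) φ
    _ = ENNReal.ofReal (Real.pi ^ (r - 1) * Metric.diam Ω) * ∫⁻ z, H z ^ r ∂sinoMeasure := by
        rw [lintegral_const_mul' _ _ ENNReal.ofReal_ne_top, ← mul_assoc,
          ENNReal.ofReal_rpow_of_nonneg Real.pi_pos.le exponent_nonneg,
          ← ENNReal.ofReal_mul (by positivity), sinoMeasure_eq_prod,
          lintegral_prod_symm _ (hH.pow_const r).aemeasurable]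

theorem eLpNorm_lintegral_sinoPoint_le_of_measurable {Ω : Set Plane}
    (hΩ : Bornology.IsBounded Ω) {p : ℝ≥0∞} (hp : 1 ≤ p) {H : ℝ × ℝ → ℝ≥0∞} (hH : Measurable H) :
    eLpNorm (fun x => ∫⁻ φ, H (sinoPoint (x, φ)) ∂angleMeasure) p (volume.restrict Ω) ≤
      ENNReal.ofReal (Real.pi ^ (1 - 1 / p.toReal) * Metric.diam Ω ^ (1 / p.toReal)) *
        eLpNorm H p sinoMeasure := by
  rcases eq_or_ne p ∞ with rfl | hp_top
  · simp only [ENNReal.toReal_top, div_zero, sub_zero, Real.rpow_one, Real.rpow_zero, mul_one,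
      eLpNorm_exponent_top]
    exact (eLpNormEssSup_mono_measure _ Measure.absolutelyContinuous_restrict).trans
      (eLpNormEssSup_lintegral_sinoPoint_le H)
  have hp0 : p ≠ 0 := (zero_lt_one.trans_le hp).ne'
  have one_le_toReal : 1 ≤ p.toReal := by simpa using ENNReal.toReal_mono hp_top hp
  simp only [eLpNorm_eq_lintegral_rpow_enorm_toReal hp0 hp_top, enorm_eq_self]
  set r := p.toReal
  have hr : 0 < r := zero_lt_one.trans_le one_le_toReal
  refine (ENNReal.rpow_le_rpow (setLIntegral_lintegral_sinoPoint_rpow_le hΩ one_le_toReal hH)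
    (z := 1 / r) (by positivity)).trans_eq ?_
  rw [ENNReal.mul_rpow_of_nonneg _ _ (by positivity),
    ENNReal.ofReal_rpow_of_nonneg (mul_nonneg (by positivity) Metric.diam_nonneg) (by positivity),
    Real.mul_rpow (by positivity) Metric.diam_nonneg, ← Real.rpow_mul Real.pi_pos.le, sub_mul,
    mul_one_div_cancel hr.ne', one_mul]

theorem eLpNorm_lintegral_sinoPoint_le {Ω : Set Plane} (hΩ : Bornology.IsBounded Ω) {p : ℝ≥0∞}
    (hp : 1 ≤ p) {H : ℝ × ℝ → ℝ≥0∞} (hH : AEMeasurable H sinoMeasure) :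
    eLpNorm (fun x => ∫⁻ φ, H (sinoPoint (x, φ)) ∂angleMeasure) p (volume.restrict Ω) ≤
      ENNReal.ofReal (Real.pi ^ (1 - 1 / p.toReal) * Metric.diam Ω ^ (1 / p.toReal)) *
        eLpNorm H p sinoMeasure := by
  rw [eLpNorm_congr_ae hH.ae_eq_mk]
  refine (eLpNorm_congr_ae ?_).trans_le
    (eLpNorm_lintegral_sinoPoint_le_of_measurable hΩ hp hH.measurable_mk)
  filter_upwards [ae_restrict_of_ae (Measure.ae_ae_of_ae_prod
    (quasiMeasurePreserving_sinoPoint.ae hH.ae_eq_mk))] with x hx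
  exact lintegral_congr_ae hx

/-- The convolution of `|a|` with `|g|` in the first variable of the sinogram `g`. It dominates the
filtered data, and its finiteness expresses that they converge absolutely. -/
noncomputable def absFiltered (a : ℝ → ℂ) (g : ℝ × ℝ → ℝ) (z : ℝ × ℝ) : ℝ≥0∞ :=
  ∫⁻ s, ‖a s * (g (z.1 - s, z.2) : ℂ)‖ₑ

/-- The unnormalized back projection of `absFiltered a g`, which dominates the reconstruction. -/
noncomputable def absReconstruction (a : ℝ → ℂ) (g : ℝ × ℝ → ℝ) (x : Plane) : ℝ≥0∞ :=
  ∫⁻ φ, absFiltered a g (sinoPoint (x, φ)) ∂angleMeasure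

theorem enorm_filtered_le (W : ℝ → ℝ) (L : ℝ) (g : ℝ × ℝ → ℝ) (z : ℝ × ℝ) :
    ‖filtered W L g z‖ₑ ≤ absFiltered (invFourier (lowPass W L)) g z :=
  enorm_integral_le_lintegral_enorm _

theorem reconstruction_eq_integral_sinoPoint (W : ℝ → ℝ) (L : ℝ) (g : ℝ × ℝ → ℝ) (x : Plane) :
    reconstruction W L g x =
      (1 / (2 * Real.pi) : ℝ) • ∫ φ, filtered W L g (sinoPoint (x, φ)) ∂angleMeasure := by
  rw [reconstruction, backProj_eq_integral_sinoPoint, smul_smul, one_div_mul_one_div]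

theorem enorm_reconstruction_le (W : ℝ → ℝ) (L : ℝ) (g : ℝ × ℝ → ℝ) (x : Plane) :
    ‖reconstruction W L g x‖ₑ ≤
      ENNReal.ofReal (1 / (2 * Real.pi)) * absReconstruction (invFourier (lowPass W L)) g x := by
  rw [reconstruction_eq_integral_sinoPoint, enorm_smul, Real.enorm_of_nonneg (by positivity)]
  gcongr
  exact (enorm_integral_le_lintegral_enorm _).trans
    (lintegral_mono fun φ => enorm_filtered_le W L g _)

variable {a : ℝ → ℂ} {g : ℝ × ℝ → ℝ} {W : ℝ → ℝ} {L : ℝ} {p : ℝ≥0∞}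

theorem aemeasurable_absFiltered (ha : Continuous a) (hg : AEStronglyMeasurable g sinoMeasure) :
    AEMeasurable (absFiltered a g) sinoMeasure :=
  (aestronglyMeasurable_filtered_integrand ha hg).enorm.lintegral_prod_right'

theorem aemeasurable_absReconstruction (ha : Continuous a)
    (hg : AEStronglyMeasurable g sinoMeasure) : AEMeasurable (absReconstruction a g) :=
  ((aemeasurable_absFiltered ha hg).comp_quasiMeasurePreserving
    quasiMeasurePreserving_sinoPoint).lintegral_prod_right'

theorem eLpNorm_absFiltered_le (ha : Continuous a) (hai : Integrable a)
    (hg : AEStronglyMeasurable g sinoMeasure) (hp : 1 ≤ p) :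
    eLpNorm (absFiltered a g) p sinoMeasure ≤
      ENNReal.ofReal (∫ t, ‖a t‖) * eLpNorm g p sinoMeasure := by
  rw [ofReal_integral_norm_eq_lintegral_enorm hai, ← lintegral_mul_const _ ha.measurable.enorm]
  refine eLpNorm_lintegral_le hp (aestronglyMeasurable_filtered_integrand ha hg).enorm
    (ha.measurable.enorm.mul_const _).aemeasurable (ae_of_all _ fun s => le_of_eq ?_)
  calc eLpNorm (fun z : ℝ × ℝ => ‖a s * (g (z.1 - s, z.2) : ℂ)‖ₑ) p sinoMeasure
      = eLpNorm (a s • fun z : ℝ × ℝ => (g (z.1 - s, z.2) : ℂ)) p sinoMeasure := eLpNorm_enorm _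
    _ = ‖a s‖ₑ * eLpNorm (fun z : ℝ × ℝ => (g (z.1 - s, z.2) : ℂ)) p sinoMeasure :=
        eLpNorm_const_smul _ _ _ _
    _ = ‖a s‖ₑ * eLpNorm (fun z : ℝ × ℝ => g (z.1 - s, z.2)) p sinoMeasure := by
        congr 1
        exact eLpNorm_congr_norm_ae (ae_of_all _ fun z => Complex.norm_real _)
    _ = ‖a s‖ₑ * eLpNorm g p sinoMeasure := by
        rw [← eLpNorm_comp_measurePreserving hg (measurePreserving_sinoMeasure_sub_right s)]
        rfl

theorem eLpNorm_absReconstruction_le {Ω : Set Plane} (hΩ : Bornology.IsBounded Ω) (hp : 1 ≤ p)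
    (ha : Continuous a) (hai : Integrable a) (hg : AEStronglyMeasurable g sinoMeasure) :
    eLpNorm (absReconstruction a g) p (volume.restrict Ω) ≤
      ENNReal.ofReal (Real.pi ^ (1 - 1 / p.toReal) * Metric.diam Ω ^ (1 / p.toReal)) *
        (ENNReal.ofReal (∫ t, ‖a t‖) * eLpNorm g p sinoMeasure) :=
  (eLpNorm_lintegral_sinoPoint_le hΩ hp (aemeasurable_absFiltered ha hg)).trans
    (by gcongr; exact eLpNorm_absFiltered_le ha hai hg hp)

theorem ae_lt_top_of_eLpNorm_ne_top {X : Type*} [MeasurableSpace X] {μ : Measure X}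
    {G : X → ℝ≥0∞} (hG : AEMeasurable G μ) (hp : p ≠ 0) (h : eLpNorm G p μ ≠ ∞) :
    ∀ᵐ x ∂μ, G x < ∞ := by
  rcases eq_or_ne p ∞ with rfl | hp_top
  · filter_upwards [ae_le_eLpNormEssSup (f := G) (μ := μ)] with x hx
    exact hx.trans_lt h.lt_top
  · have lintegral_lt_top := lintegral_rpow_enorm_lt_top_of_eLpNorm_lt_top hp hp_top h.lt_top
    filter_upwards [ae_lt_top' (hG.pow_const _) lintegral_lt_top.ne] with x hx
    exact (ENNReal.rpow_lt_top_iff_of_pos (ENNReal.toReal_pos hp hp_top)).1 hx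

end DataError

section Noise

/-- The two integrals that define the reconstruction from `g` converge at the point `x`: the
convolution for almost every angle, and the back projection. Bochner integrals vanish where they
diverge, so that the reconstruction is linear in the data only at such points. -/
def ReconstructionConverges (W : ℝ → ℝ) (L : ℝ) (g : ℝ × ℝ → ℝ) (x : Plane) : Prop :=
  (∀ᵐ φ ∂angleMeasure, Integrable fun s => invFourier (lowPass W L) s *
      (g ((sinoPoint (x, φ)).1 - s, (sinoPoint (x, φ)).2) : ℂ)) ∧
    Integrable (fun φ => filtered W L g (sinoPoint (x, φ))) angleMeasure

variable {W : ℝ → ℝ} {L : ℝ} {g u : ℝ × ℝ → ℝ} {f : Plane → ℝ} {p : ℝ≥0∞} {Ω : Set Plane}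

theorem ReconstructionConverges.reconstruction_sub {x : Plane}
    (hu : ReconstructionConverges W L u x) (hg : ReconstructionConverges W L g x) :
    reconstruction W L (fun z => u z - g z) x =
      reconstruction W L u x - reconstruction W L g x := by
  have filtered_sub : ∀ᵐ φ ∂angleMeasure, filtered W L (fun z => u z - g z) (sinoPoint (x, φ)) =
      filtered W L u (sinoPoint (x, φ)) - filtered W L g (sinoPoint (x, φ)) := by
    filter_upwards [hu.1, hg.1] with φ hu hg
    simp only [filtered, Complex.ofReal_sub, mul_sub]
    exact integral_sub hu hg
  simp only [reconstruction_eq_integral_sinoPoint]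
  rw [integral_congr_ae filtered_sub, integral_sub hu.2 hg.2, smul_sub]

theorem reconstructionConverges_radon (hf : Integrable f)
    (ha : Continuous (invFourier (lowPass W L))) (x : Plane) :
    ReconstructionConverges W L (radon f) x := by
  obtain ⟨C, haC⟩ := exists_norm_invFourier_le (lowPass W L)
  exact ⟨ae_of_all _ fun φ => integrable_mul_radon hf ha haC _ φ,
    (intervalIntegrable_iff_integrableOn_Ico_of_le Real.pi_pos.le).1
      (intervalIntegrable_filtered_radon hf ha x)⟩

theorem ae_reconstructionConverges {μ : Measure Plane} (hμ : μ ≪ volume)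
    (ha : Continuous (invFourier (lowPass W L))) (hg : AEStronglyMeasurable g sinoMeasure)
    (hfin : ∀ᵐ x ∂μ, absReconstruction (invFourier (lowPass W L)) g x < ∞) :
    ∀ᵐ x ∂μ, ReconstructionConverges W L g x := by
  have integrand := hμ.ae_le (Measure.ae_ae_of_ae_prod (quasiMeasurePreserving_sinoPoint.ae
    (aestronglyMeasurable_filtered_integrand ha hg).prodMk_left))
  have abs_filtered := hμ.ae_le ((aemeasurable_absFiltered ha hg).comp_quasiMeasurePreserving
    quasiMeasurePreserving_sinoPoint).aestronglyMeasurable.prodMk_left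
  have filtered_data := hμ.ae_le (aestronglyMeasurable_filtered_sinoPoint ha hg).prodMk_left
  filter_upwards [integrand, abs_filtered, filtered_data, hfin] with x integrand abs_filtered
    filtered_data hfin
  refine ⟨?_, filtered_data, (lintegral_mono fun φ => enorm_filtered_le W L g _).trans_lt hfin⟩
  filter_upwards [integrand, ae_lt_top' abs_filtered.aemeasurable hfin.ne] with φ hm hlt
  exact ⟨hm, hlt⟩

theorem ae_reconstructionConverges_of_eLpNorm_ne_top (hΩ : Bornology.IsBounded Ω) (hp : 1 ≤ p)
    (ha : Continuous (invFourier (lowPass W L)))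
    (hai : Integrable (invFourier (lowPass W L))) (hg : AEStronglyMeasurable g sinoMeasure)
    (hgp : eLpNorm g p sinoMeasure ≠ ∞) :
    ∀ᵐ x ∂volume.restrict Ω, ReconstructionConverges W L g x := by
  refine ae_reconstructionConverges Measure.absolutelyContinuous_restrict ha hg
    (ae_lt_top_of_eLpNorm_ne_top (aemeasurable_absReconstruction ha hg).restrict
      (zero_lt_one.trans_le hp).ne' (ne_top_of_le_ne_top ?_
        (eLpNorm_absReconstruction_le hΩ hp ha hai hg)))
  exact ENNReal.mul_ne_top ENNReal.ofReal_ne_top (ENNReal.mul_ne_top ENNReal.ofReal_ne_top hgp)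

theorem cData_eq (W : ℝ → ℝ) (Ω : Set Plane) (p : ℝ≥0∞) :
    cData W Ω p = 1 / (2 * Real.pi) *
      (Real.pi ^ (1 - 1 / p.toReal) * Metric.diam Ω ^ (1 / p.toReal)) *
        ∫ t : ℝ, ‖invFourier (lowPass W 1) t‖ := by
  have : 0 < Real.pi ^ (1 / p.toReal) := by positivity
  rw [cData, Real.rpow_sub Real.pi_pos, Real.rpow_one]
  field_simp

theorem eLpNorm_reconstruction_le (hΩ : Bornology.IsBounded Ω) (hp : 1 ≤ p)
    (hA : Integrable (lowPass W 1)) (hAinv : Integrable (invFourier (lowPass W 1)))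
    (hL : 0 < L) (hg : AEStronglyMeasurable g sinoMeasure) :
    eLpNorm (reconstruction W L g) p (volume.restrict Ω) ≤
      ENNReal.ofReal (cData W Ω p * L) * eLpNorm g p sinoMeasure := by
  have : 0 ≤ Metric.diam Ω := Metric.diam_nonneg
  set a := invFourier (lowPass W L)
  calc eLpNorm (reconstruction W L g) p (volume.restrict Ω)
      ≤ ENNReal.ofReal (1 / (2 * Real.pi)) *
          eLpNorm (absReconstruction a g) p (volume.restrict Ω) :=
        eLpNorm_le_nnreal_smul_eLpNorm_of_ae_le_mul'
          (ae_of_all _ (enorm_reconstruction_le W L g)) p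
    _ ≤ ENNReal.ofReal (1 / (2 * Real.pi)) *
          (ENNReal.ofReal (Real.pi ^ (1 - 1 / p.toReal) * Metric.diam Ω ^ (1 / p.toReal)) *
            (ENNReal.ofReal (∫ t, ‖a t‖) * eLpNorm g p sinoMeasure)) := by
        gcongr
        exact eLpNorm_absReconstruction_le hΩ hp (continuous_invFourier_lowPass hA hL)
          (integrable_invFourier_lowPass hL hAinv) hg
    _ = ENNReal.ofReal (cData W Ω p * L) * eLpNorm g p sinoMeasure := by
        rw [← mul_assoc, ← mul_assoc, ← ENNReal.ofReal_mul (by positivity),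
          ← ENNReal.ofReal_mul (by positivity), integral_norm_invFourier_lowPass W hL, cData_eq]
        congr 2; ring

theorem eLpNorm_reconstruction_radon_sub_le (hΩ : Bornology.IsBounded Ω) (hp : 1 ≤ p)
    (hf : Integrable f) (hA : Integrable (lowPass W 1))
    (hAinv : Integrable (invFourier (lowPass W 1))) (hL : 0 < L)
    (hg : AEStronglyMeasurable g sinoMeasure)
    (herr : eLpNorm (fun z => radon f z - g z) p sinoMeasure ≠ ∞) :
    eLpNorm (fun x => reconstruction W L (radon f) x - reconstruction W L g x) p
        (volume.restrict Ω) ≤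
      ENNReal.ofReal (cData W Ω p * L) * eLpNorm (fun z => radon f z - g z) p sinoMeasure := by
  have ha := continuous_invFourier_lowPass hA hL
  have error_measurable : AEStronglyMeasurable (fun z => radon f z - g z) sinoMeasure :=
    (aestronglyMeasurable_radon hf.aestronglyMeasurable).sub hg
  refine (eLpNorm_congr_ae ?_).trans_le
    (eLpNorm_reconstruction_le hΩ hp hA hAinv hL error_measurable)
  filter_upwards [ae_reconstructionConverges_of_eLpNorm_ne_top hΩ hp ha
    (integrable_invFourier_lowPass hL hAinv) error_measurable herr] with x hx
  have linearity := (reconstructionConverges_radon hf ha x).reconstruction_sub hx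
  simp only [sub_sub_cancel] at linearity
  rw [linearity, sub_sub_cancel]

end Noise

section ErrorBound

theorem cApprox_nonneg (W : ℝ → ℝ) (n : ℕ) {θ : ℝ} (hθ : 0 < θ) (q : ℝ≥0∞) :
    0 ≤ cApprox W n θ q :=
  mul_nonneg (mul_nonneg (cFrac_nonneg hθ q)
      (div_nonneg (Real.Gamma_nonneg_of_nonneg (by positivity))
        (Real.Gamma_nonneg_of_nonneg (by positivity))))
    (integral_nonneg fun x => by positivity)

theorem cData_nonneg (W : ℝ → ℝ) (Ω : Set Plane) (p : ℝ≥0∞) : 0 ≤ cData W Ω p :=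
  mul_nonneg (mul_nonneg (by positivity) (Real.rpow_nonneg Metric.diam_nonneg _))
    (integral_nonneg fun t => norm_nonneg _)

variable {n : ℕ} {θ : ℝ} {p q : ℝ≥0∞} {f : Plane → ℝ} {W : ℝ → ℝ} {Ω : Set Plane}
  {g : ℝ × ℝ → ℝ} {L α N δ : ℝ}

theorem eLpNorm_sub_reconstruction_radon_le (hθ : 0 < θ) (hp : 1 ≤ p) (hq : 1 ≤ q)
    (hf : Integrable f) (hfB : besovSeminorm n θ p q f ≠ ⊤) (hWeven : Function.Even W)
    (hW0 : W 0 = 1) (hWc : ContinuousAt W 0) (hA : Integrable (lowPass W 1))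
    (hK : Integrable (convKernel W 1))
    (hmom : ∀ j₁ j₂ : ℕ, 1 ≤ j₁ + j₂ → j₁ + j₂ ≤ n →
      ∫ x : Plane, (x 0 ^ j₁ * x 1 ^ j₂) • convKernel W 1 x = 0)
    (hKα : Integrable (fun x : Plane => ‖x‖ ^ (n + θ) * ‖convKernel W 1 x‖)) (hL : 0 < L) :
    eLpNorm (fun x => (f x : ℂ) - reconstruction W L (radon f) x) p volume ≤
      ENNReal.ofReal (cApprox W n θ q * L ^ (-(n + θ))) * besovSeminorm n θ p q f := by
  have mass : ∫ x, convKernel W L x = 1 := by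
    rw [integral_convKernel_scale W hL, integral_convKernel hWeven hW0 hWc hA hK]
  simp only [reconstruction_radon hf (continuous_invFourier_lowPass hA hL)]
  refine (eLpNorm_sub_convolution_le hf hθ hp hq hfB (integrable_convKernel hL hK) mass
    (integrable_rpow_norm_mul_convKernel hL hKα) fun j₁ j₂ h₁ h₂ =>
      integral_monomial_convKernel_scale hL (hmom j₁ j₂ h₁ h₂)).trans_eq ?_
  rw [integral_rpow_norm_mul_convKernel W hL, cApprox]
  congr 2; ring

theorem aestronglyMeasurable_sub_reconstruction (hf : Integrable f)
    (hA : Integrable (lowPass W 1)) (hL : 0 < L) (hg : AEStronglyMeasurable g sinoMeasure) :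
    AEStronglyMeasurable fun x => (f x : ℂ) - reconstruction W L g x :=
  (Complex.continuous_ofReal.comp_aestronglyMeasurable hf.aestronglyMeasurable).sub
    (aestronglyMeasurable_reconstruction (continuous_invFourier_lowPass hA hL) hg)

theorem eLpNorm_sub_reconstruction_le (hθ : 0 < θ) (hp : 1 ≤ p) (hq : 1 ≤ q)
    (hΩ : Bornology.IsBounded Ω) (hf : Integrable f) (hfB : besovSeminorm n θ p q f ≠ ⊤)
    (hWeven : Function.Even W) (hW0 : W 0 = 1) (hWc : ContinuousAt W 0)
    (hA : Integrable (lowPass W 1)) (hAinv : Integrable (invFourier (lowPass W 1)))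
    (hK : Integrable (convKernel W 1))
    (hmom : ∀ j₁ j₂ : ℕ, 1 ≤ j₁ + j₂ → j₁ + j₂ ≤ n →
      ∫ x : Plane, (x 0 ^ j₁ * x 1 ^ j₂) • convKernel W 1 x = 0)
    (hKα : Integrable (fun x : Plane => ‖x‖ ^ (n + θ) * ‖convKernel W 1 x‖)) (hL : 0 < L)
    (hg : AEStronglyMeasurable g sinoMeasure)
    (herr : eLpNorm (fun z => radon f z - g z) p sinoMeasure ≠ ∞) :
    eLpNorm (fun x => (f x : ℂ) - reconstruction W L g x) p (volume.restrict Ω) ≤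
      ENNReal.ofReal (cApprox W n θ q * L ^ (-(n + θ))) * besovSeminorm n θ p q f +
        ENNReal.ofReal (cData W Ω p * L) *
          eLpNorm (fun z => radon f z - g z) p sinoMeasure := by
  have radon_measurable := aestronglyMeasurable_radon hf.aestronglyMeasurable
  have ha := continuous_invFourier_lowPass hA hL
  have error_split : (fun x => (f x : ℂ) - reconstruction W L g x) =
      (fun x => (f x : ℂ) - reconstruction W L (radon f) x) +
        fun x => reconstruction W L (radon f) x - reconstruction W L g x :=
    funext fun x => (sub_add_sub_cancel _ _ _).symm
  rw [error_split]
  refine (eLpNorm_add_le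
    (aestronglyMeasurable_sub_reconstruction hf hA hL radon_measurable).restrict
    ((aestronglyMeasurable_reconstruction ha radon_measurable).sub
      (aestronglyMeasurable_reconstruction ha hg)).restrict hp).trans (add_le_add ?_ ?_)
  · exact (eLpNorm_mono_measure _ Measure.restrict_le_self).trans
      (eLpNorm_sub_reconstruction_radon_le hθ hp hq hf hfB hWeven hW0 hWc hA hK hmom hKα hL)
  · exact eLpNorm_reconstruction_radon_sub_le hΩ hp hf hA hAinv hL hg herr

theorem bandwidth_pos (hN : 0 < N) (hδ : 0 < δ) : 0 < bandwidth α N δ := by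
  unfold bandwidth; positivity

theorem bandwidth_rpow_neg_mul (hα : 0 < α) (hN : 0 < N) (hδ : 0 < δ) :
    bandwidth α N δ ^ (-α) * N = N ^ (1 / (α + 1)) * δ ^ (α / (α + 1)) := by
  have : α + 1 ≠ 0 := by positivity
  rw [bandwidth, Real.mul_rpow (by positivity) (by positivity), ← Real.rpow_mul hδ.le,
    ← Real.rpow_mul hN.le, mul_assoc, ← Real.rpow_add_one hN.ne', mul_comm]
  congr 2 <;> field_simp
  ring

theorem bandwidth_mul (hα : 0 < α) (hδ : 0 < δ) :
    bandwidth α N δ * δ = N ^ (1 / (α + 1)) * δ ^ (α / (α + 1)) := by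
  have : α + 1 ≠ 0 := by positivity
  rw [bandwidth, mul_right_comm, ← Real.rpow_add_one hδ.ne', mul_comm]
  congr 2
  field_simp
  ring

theorem bandwidth_balance (hα : 0 < α) (hN : 0 < N) (hδ : 0 < δ) {c d : ℝ} (hc : 0 ≤ c)
    (hd : 0 ≤ d) :
    ENNReal.ofReal (c * bandwidth α N δ ^ (-α)) * ENNReal.ofReal N +
        ENNReal.ofReal (d * bandwidth α N δ) * ENNReal.ofReal δ =
      ENNReal.ofReal ((c + d) * N ^ (1 / (α + 1)) * δ ^ (α / (α + 1))) := by
  rw [← ENNReal.ofReal_mul' hN.le, ← ENNReal.ofReal_mul' hδ.le, mul_assoc,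
    bandwidth_rpow_neg_mul hα hN hδ, mul_assoc, bandwidth_mul hα hδ,
    ← ENNReal.ofReal_add (by positivity) (by positivity)]
  congr 1; ring

theorem eLpNorm_sub_reconstruction_bandwidth_le (hθ : 0 < θ) (hα : α = n + θ) (hp : 1 ≤ p)
    (hq : 1 ≤ q) (hΩ : Bornology.IsBounded Ω) (hf : Integrable f)
    (hfB : besovSeminorm n θ p q f ≠ ⊤) (hf0 : besovSeminorm n θ p q f ≠ 0)
    (hWeven : Function.Even W) (hW0 : W 0 = 1) (hWc : ContinuousAt W 0)
    (hA : Integrable (lowPass W 1)) (hAinv : Integrable (invFourier (lowPass W 1)))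
    (hK : Integrable (convKernel W 1))
    (hmom : ∀ j₁ j₂ : ℕ, 1 ≤ j₁ + j₂ → j₁ + j₂ ≤ n →
      ∫ x : Plane, (x 0 ^ j₁ * x 1 ^ j₂) • convKernel W 1 x = 0)
    (hKα : Integrable (fun x : Plane => ‖x‖ ^ α * ‖convKernel W 1 x‖)) (hδ : 0 < δ)
    (hg : AEStronglyMeasurable g sinoMeasure)
    (herr : eLpNorm (fun z => radon f z - g z) p sinoMeasure ≤ ENNReal.ofReal δ) :
    eLpNorm (fun x => (f x : ℂ) - reconstruction W
        (bandwidth α (besovSeminorm n θ p q f).toReal δ) g x) p (volume.restrict Ω) ≤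
      ENNReal.ofReal ((cApprox W n θ q + cData W Ω p) *
        (besovSeminorm n θ p q f).toReal ^ (1 / (α + 1)) * δ ^ (α / (α + 1))) := by
  have hN : 0 < (besovSeminorm n θ p q f).toReal := ENNReal.toReal_pos hf0 hfB
  have hα0 : 0 < α := by rw [hα]; positivity
  rw [← bandwidth_balance hα0 hN hδ (cApprox_nonneg W n hθ q) (cData_nonneg W Ω p),
    ENNReal.ofReal_toReal hfB, hα]
  rw [hα] at hKα
  refine (eLpNorm_sub_reconstruction_le hθ hp hq hΩ hf hfB hWeven hW0 hWc hA hAinv hK hmom hKα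
    (bandwidth_pos hN hδ) hg (ne_top_of_le_ne_top ENNReal.ofReal_ne_top herr)).trans ?_
  gcongr

theorem isBigO_toReal_of_forall_le_ofReal {u : ℝ → ℝ≥0∞} {v : ℝ → ℝ} {c : ℝ} (hc : 0 ≤ c)
    (hv : ∀ δ, 0 < δ → 0 ≤ v δ) (h : ∀ δ, 0 < δ → u δ ≤ ENNReal.ofReal (c * v δ)) :
    (fun δ => (u δ).toReal) =O[𝓝[>] 0] v := by
  refine IsBigO.of_bound c ?_
  filter_upwards [self_mem_nhdsWithin] with δ (hδ : 0 < δ)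
  rw [Real.norm_of_nonneg ENNReal.toReal_nonneg, Real.norm_of_nonneg (hv δ hδ)]
  exact ENNReal.toReal_le_of_le_ofReal (mul_nonneg hc (hv δ hδ)) (h δ hδ)

end ErrorBound

end FBP

theorem mainTheorem4_general
    (n : ℕ) (θ α : ℝ) (hθ0 : 0 < θ) (hα : α = n + θ)
    (p q : ℝ≥0∞) (hp : 1 ≤ p) (hq : 1 ≤ q)
    (Ω : Set FBP.Plane) (hΩ : Bornology.IsBounded Ω)
    (f : FBP.Plane → ℝ) (hf1 : Integrable f) (hfB : FBP.besovSeminorm n θ p q f ≠ ⊤)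
    (hf0 : FBP.besovSeminorm n θ p q f ≠ 0)
    (W : ℝ → ℝ) (hWeven : Function.Even W) (hW0 : W 0 = 1) (hWc : ContinuousAt W 0)
    (hA1 : Integrable (FBP.lowPass W 1)) (hAinv : Integrable (FBP.invFourier (FBP.lowPass W 1)))
    (hK : Integrable (FBP.convKernel W 1))
    (hmom : ∀ j₁ j₂ : ℕ, 1 ≤ j₁ + j₂ → j₁ + j₂ ≤ n →
      ∫ x : FBP.Plane, (x 0 ^ j₁ * x 1 ^ j₂) • FBP.convKernel W 1 x = 0)
    (hKα : Integrable fun x : FBP.Plane => ‖x‖ ^ α * ‖FBP.convKernel W 1 x‖) :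
    (∀ δ : ℝ, 0 < δ → ∀ g : ℝ × ℝ → ℝ, AEStronglyMeasurable g FBP.sinoMeasure →
      eLpNorm (fun z => FBP.radon f z - g z) p FBP.sinoMeasure ≤ ENNReal.ofReal δ →
      ∀ L : ℝ, L = FBP.bandwidth α (FBP.besovSeminorm n θ p q f).toReal δ →
        MemLp (fun x => (f x : ℂ) - FBP.reconstruction W L g x) p (volume.restrict Ω) ∧
        eLpNorm (fun x => (f x : ℂ) - FBP.reconstruction W L g x) p (volume.restrict Ω) ≤
          ENNReal.ofReal ((FBP.cApprox W n θ q + FBP.cData W Ω p) *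
            (FBP.besovSeminorm n θ p q f).toReal ^ (1 / (α + 1)) * δ ^ (α / (α + 1)))) ∧
    (∀ g : ℝ → ℝ × ℝ → ℝ,
      (∀ δ : ℝ, 0 < δ → AEStronglyMeasurable (g δ) FBP.sinoMeasure ∧
        eLpNorm (fun z => FBP.radon f z - g δ z) p FBP.sinoMeasure ≤ ENNReal.ofReal δ) →
      (fun δ : ℝ => (eLpNorm (fun x => (f x : ℂ) - FBP.reconstruction W
          (FBP.bandwidth α (FBP.besovSeminorm n θ p q f).toReal δ) (g δ) x)
          p (volume.restrict Ω)).toReal)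
        =O[𝓝[>] 0] (fun δ : ℝ => δ ^ (α / (α + 1)))) := by
  have hc := add_nonneg (FBP.cApprox_nonneg W n hθ0 q) (FBP.cData_nonneg W Ω p)
  have hN := ENNReal.toReal_pos hf0 hfB
  have error_le {δ : ℝ} (hδ : 0 < δ) {g : ℝ × ℝ → ℝ} :=
    FBP.eLpNorm_sub_reconstruction_bandwidth_le (g := g) hθ0 hα hp hq hΩ hf1 hfB hf0 hWeven hW0
      hWc hA1 hAinv hK hmom hKα hδ
  constructor
  · rintro δ hδ g hg herr L rfl
    have measurable_error := FBP.aestronglyMeasurable_sub_reconstruction hf1 hA1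
      (FBP.bandwidth_pos (α := α) hN hδ) hg
    exact ⟨⟨measurable_error.restrict, (error_le hδ hg herr).trans_lt ENNReal.ofReal_lt_top⟩,
      error_le hδ hg herr⟩
  · exact fun g hg => FBP.isBigO_toReal_of_forall_le_ofReal (mul_nonneg hc (by positivity))
      (fun δ hδ => by positivity) fun δ hδ => error_le hδ (hg δ hδ).1 (hg δ hδ).2

theorem mainTheorem4
    (n : ℕ) (θ α : ℝ) (hθ0 : 0 < θ) (hθ1 : θ < 1) (hα : α = n + θ)
    (p q : ℝ≥0∞) (hp : 1 ≤ p) (hq : 1 ≤ q)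
    (Ω : Set FBP.Plane) (hΩ : IsCompact Ω)
    (f : FBP.Plane → ℝ) (hf1 : Integrable f volume) (hfB : FBP.MemBesov n θ p q f)
    (hf0 : FBP.besovSeminorm n θ p q f ≠ 0)
    (hsupp : ∀ᵐ x ∂(volume : Measure FBP.Plane), x ∉ Ω → f x = 0)
    (W : ℝ → ℝ) (hW : MemLp W ⊤ volume) (hWeven : Function.Even W)
    (hW0 : W 0 = 1) (hWc : ContinuousAt W 0)
    (hA1 : Integrable (FBP.lowPass W 1) volume) (hA2 : MemLp (FBP.lowPass W 1) 2 volume)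
    (hAinv : Integrable (FBP.invFourier (FBP.lowPass W 1)) volume)
    (hK : Integrable (FBP.convKernel W 1) volume)
    (hmom : ∀ j₁ j₂ : ℕ, 1 ≤ j₁ + j₂ → j₁ + j₂ ≤ n →
      ∫ x : FBP.Plane, (x 0 ^ j₁ * x 1 ^ j₂) • FBP.convKernel W 1 x = 0)
    (hKα : Integrable (fun x : FBP.Plane => ‖x‖ ^ α * ‖FBP.convKernel W 1 x‖) volume) :
    (∀ δ : ℝ, 0 < δ → ∀ g : ℝ × ℝ → ℝ, MemLp g p FBP.sinoMeasure →
      eLpNorm (fun z => FBP.radon f z - g z) p FBP.sinoMeasure ≤ ENNReal.ofReal δ →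
      ∀ L : ℝ, L = FBP.bandwidth α (FBP.besovSeminorm n θ p q f).toReal δ →
        MemLp (fun x => (f x : ℂ) - FBP.reconstruction W L g x) p (volume.restrict Ω) ∧
        eLpNorm (fun x => (f x : ℂ) - FBP.reconstruction W L g x) p (volume.restrict Ω) ≤
          ENNReal.ofReal ((FBP.cApprox W n θ q + FBP.cData W Ω p) *
            (FBP.besovSeminorm n θ p q f).toReal ^ (1 / (α + 1)) * δ ^ (α / (α + 1)))) ∧
    (∀ g : ℝ → ℝ × ℝ → ℝ,
      (∀ δ : ℝ, 0 < δ → MemLp (g δ) p FBP.sinoMeasure ∧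
        eLpNorm (fun z => FBP.radon f z - g δ z) p FBP.sinoMeasure ≤ ENNReal.ofReal δ) →
      (fun δ : ℝ => (eLpNorm (fun x => (f x : ℂ) - FBP.reconstruction W
          (FBP.bandwidth α (FBP.besovSeminorm n θ p q f).toReal δ) (g δ) x)
          p (volume.restrict Ω)).toReal)
        =O[𝓝[>] 0] (fun δ : ℝ => δ ^ (α / (α + 1)))) := by
  have h := mainTheorem4_general n θ α hθ0 hα p q hp hq Ω hΩ.isBounded f hf1 hfB.2.ne hf0 W hWeven
    hW0 hWc hA1 hAinv hK hmom hKα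
  exact ⟨fun δ hδ g hg => h.1 δ hδ g hg.1,
    fun g hg => h.2 g fun δ hδ => ⟨(hg δ hδ).1.1, (hg δ hδ).2⟩⟩
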